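/- Let $\alpha\ge 1$, $0<\theta_0\le 2\pi$, and let $\Omega=\{(r,\theta): 1<r<2,\ 0<\theta<\theta_0\}\subset\mathbb{R}^2$ in polar coordinates, with $\bm e_r=(\cos\theta,\sin\theta)$ and $\bm e_\theta=(-\sin\theta,\cos\theta)$. Let $\bm u=u_\theta\bm e_\theta+u_r\bm e_r$ and $P$ be a classical solution of the stationary incompressible Euler equations $$\bm u\cdot\nabla\bm u=-\nabla P,\qquad \operatorname{div}\bm u=0\qquad\text{in }\Omega,$$ with $\bm u\in C^2(\overline\Omega)$, that is, as a function of $(r,\theta)$, $\bm u$ extends to a $C^2$ function on $[1,2]\times[0,\theta_0]$ (when $\theta_0=2\pi$ the edges $\theta=0$ and $\theta=2\pi$ are regarded as distinct). Assume that $|u_\theta|>0$ for all $1\le r\le 2$, $0\le\theta\le\theta_0$, that for some constants $c_1,c_2$ $$u_\theta|_{\theta=0}=\frac{c_1}{r^\alpha},\qquad u_\theta|_{\theta=\theta_0}=\frac{c_2}{r^\alpha}\qquad(1\le r\le 2),$$ and that $$u_r|_{\theta=0}=u_r|_{\theta=\theta_0},\qquad u_r|_{r=1}=u_r|_{r=2}=0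 .$$ Then $c_1=c_2=c$ for some $c\ne 0$. If, moreover, $$c^{-1}\,\partial_\theta(r^\alpha u_r)|_{\theta=0}\ge 1-\alpha\ \text{ for all } r\in[1,2],\qquad\text{or}\qquad c^{-1}\,\partial_\theta(r^\alpha u_r)|_{\theta=\theta_0}\ge 1-\alpha\ \text{ for all } r\in[1,2],$$ then $\bm u$ is $(-\alpha)$-homogeneous, $P$ is $(-2\alpha)$-homogeneous up to an additive constant, and $$\bm u=\frac{c}{r^\alpha}\,\bm e_\theta\ \text{ on }\overline\Omega,\qquad P=-\frac{c^2}{2\alpha\, r^{2\alpha}}+C\ \text{ in }\Omega$$ for some constant $C$. -/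

import Mathlib

noncomputable section

namespace SectorEuler

/-- The Euclidean plane. -/
abbrev Plane : Type := EuclideanSpace ℝ (Fin 2)

/-- The point of the plane with polar coordinates `(r, θ)`. -/
def polarPoint (r θ : ℝ) : Plane := !₂[r * Real.cos θ, r * Real.sin θ]

/-- The unit vector `e_r` at angle `θ`. -/
def eR (θ : ℝ) : Plane := !₂[Real.cos θ, Real.sin θ]

/-- The unit vector `e_θ` at angle `θ`. -/
def eTheta (θ : ℝ) : Plane := !₂[-Real.sin θ, Real.cos θ]

/-- The truncated sector `{a < r < b, 0 < θ < θ₀}`, as a subset of the plane. -/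
def sector (a b θ₀ : ℝ) : Set Plane :=
  {x | ∃ r ∈ Set.Ioo a b, ∃ θ ∈ Set.Ioo 0 θ₀, x = polarPoint r θ}

/-- The closed sector in polar coordinates. For `θ₀ = 2π` the edges `θ = 0` and `θ = θ₀` are
kept apart (they are the two sides of a slit). -/
def closedPolar (a b θ₀ : ℝ) : Set (ℝ × ℝ) := Set.Icc a b ×ˢ Set.Icc 0 θ₀

/-- The planar field `u` on the open sector is of class `C²` up to the boundary, and `U`, a function
of `(r, θ)`, is its `C²` extension to the closed sector. -/
def IsC2UpToBoundary (a b θ₀ : ℝ) (u : Plane → Plane) (U : ℝ × ℝ → Plane) : Prop :=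
  ContDiffOn ℝ 2 U (closedPolar a b θ₀) ∧
    ∀ r ∈ Set.Ioo a b, ∀ θ ∈ Set.Ioo 0 θ₀, u (polarPoint r θ) = U (r, θ)

/-- The radial component `u_r = u · e_r` of a field given as a function of `(r, θ)`. -/
def radial (U : ℝ × ℝ → Plane) (r θ : ℝ) : ℝ := inner ℝ (U (r, θ)) (eR θ)

/-- The angular component `u_θ = u · e_θ` of a field given as a function of `(r, θ)`. -/
def angular (U : ℝ × ℝ → Plane) (r θ : ℝ) : ℝ := inner ℝ (U (r, θ)) (eTheta θ)

/-- The divergence of a planar vector field. -/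
def divergence (u : Plane → Plane) (x : Plane) : ℝ :=
  ∑ i : Fin 2, (fderiv ℝ u x (EuclideanSpace.single i 1)) i

/-- `(u, P)` is a classical solution on `Ω` of the stationary incompressible Euler equations
`(u · ∇) u + ∇ P = 0`, `div u = 0`. -/
def IsEulerSolution (Ω : Set Plane) (u : Plane → Plane) (P : Plane → ℝ) : Prop :=
  ∀ x ∈ Ω, DifferentiableAt ℝ u x ∧ DifferentiableAt ℝ P x ∧
    fderiv ℝ u x (u x) + gradient P x = 0 ∧ divergence u x = 0

/-- `f` is homogeneous of degree `β` within `Ω`. -/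
def HomogeneousWithin {E : Type*} [SMul ℝ E] (β : ℝ) (Ω : Set Plane) (f : Plane → E) : Prop :=
  ∀ x ∈ Ω, ∀ t : ℝ, 0 < t → t • x ∈ Ω → f (t • x) = (t ^ β) • f x

/-- The derivative `∂_θ (r ^ α u_r)` at `(r, θ)`, one-sided on the edges of `0 ≤ θ ≤ θ₀`. -/
def dThetaRadial (α θ₀ : ℝ) (U : ℝ × ℝ → Plane) (r θ : ℝ) : ℝ :=
  derivWithin (fun φ => r ^ α * radial U r φ) (Set.Icc 0 θ₀) θ

end SectorEuler

end

/-! Write `W = u_r`, `V = u_θ` and `p = W / V`, and let `ω` be the vorticity. Incompressibility and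
transport of vorticity combine into a single equation in divergence form, `∂_r (r³ V² p_r) + ∂_θ (r
V² p_θ) = -2 r² W ω`. Multiplying by `p` and integrating over the sector leaves `∫ (r³ V² p_r² + r
V² p_θ² - 2 r² W² ω / V)` plus boundary terms. If the boundary terms vanish and `ω / V ≤ 0`, every
term of the integrand is zero; then `p` is constant along rays and zero on an arc, so `W = 0`
(`PolarFlow.radial_eq_zero`). The divergence equation then makes `V` independent of the angle, and
the pressure is found by integration.

Both requirements come from one conservation law: since the arcs are not crossed, `∫ φ V dr` is the
same on every ray for each transported `φ` (`PolarFlow.integral_transported`). The choice `φ = 1`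
gives `c₁ = c₂`.

Sign: the edge hypothesis says exactly that `c ω ≤ 0` on that edge, and taking for `φ` a function of
`c ω` that is positive precisely where `c ω > 0` carries this to every ray
(`PolarFlow.vorticity_mul_nonpos`).

Boundary terms: they vanish on the arcs because `W` does. On the two edges they cancel if `V`, `W`,
`V_θ`, `W_θ` agree there, and the last of these needs equal vorticity. With a stream function `ψ`,
all `q(ψ) ω` with `q` a polynomial are transported; since `ψ` is injective along an edge,
Stone–Weierstrass shows that `ω` agrees on the edges (`PolarFlow.vorticity_edge_eq`). -/

namespace SectorEuler

/-! ### Vanishing criteria for integrals and flux conservation on rectangles -/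

open MeasureTheory Set

/-- A continuous nonnegative function with zero integral over a regular compact set vanishes. -/
theorem eqOn_zero_of_setIntegral_eq_zero {X : Type*} [TopologicalSpace X] [MeasurableSpace X]
    [BorelSpace X] {μ : Measure X} [μ.IsOpenPosMeasure] [IsFiniteMeasureOnCompacts μ]
    {s : Set X} (hs : IsCompact s) (hm : MeasurableSet s) (hcl : s ⊆ closure (interior s))
    {f : X → ℝ} (hf : ContinuousOn f s) (h0 : ∀ x ∈ s, 0 ≤ f x) (hI : ∫ x in s, f x ∂μ = 0) :
    ∀ x ∈ s, f x = 0 := by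
  have hint : IntegrableOn f s μ := by
    refine ⟨?_, ?_⟩
    · exact (hf.aestronglyMeasurable_of_isCompact hs hm)
    · obtain ⟨M, hM⟩ := hs.exists_bound_of_continuousOn hf
      refine HasFiniteIntegral.restrict_of_bounded M hs.measure_lt_top ?_
      exact (ae_restrict_iff' hm).2 (Filter.Eventually.of_forall hM)
  have h1 := (setIntegral_eq_zero_iff_of_nonneg_ae
    ((ae_restrict_iff' hm).2 (Filter.Eventually.of_forall h0)) hint).1 hI
  -- Almost-everywhere vanishing becomes pointwise because every point of `s` is a limit of interior
  -- points and open sets have positive measure.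
  exact Measure.eqOn_of_ae_eq h1 hf continuousOn_const hcl

theorem eqOn_zero_of_intervalIntegral_eq_zero {a b : ℝ} (hab : a < b) {f : ℝ → ℝ}
    (hf : ContinuousOn f (Icc a b)) (h0 : ∀ x ∈ Icc a b, 0 ≤ f x)
    (hI : ∫ x in a..b, f x = 0) : ∀ x ∈ Icc a b, f x = 0 := by
  refine eqOn_zero_of_setIntegral_eq_zero isCompact_Icc measurableSet_Icc
    (closure_interior_Icc hab.ne).symm.subset hf h0 (μ := volume) ?_
  rw [integral_Icc_eq_integral_Ioc, ← intervalIntegral.integral_of_le hab.le, hI]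

/-- A continuous function orthogonal to all polynomials in an injective function vanishes. -/
theorem eqOn_zero_of_forall_polynomial_integral_eq_zero {a b : ℝ} (hab : a < b) {ψ k : ℝ → ℝ}
    (hψ : ContinuousOn ψ (Icc a b)) (hinj : InjOn ψ (Icc a b)) (hk : ContinuousOn k (Icc a b))
    (h : ∀ p : Polynomial ℝ, ∫ x in a..b, p.eval (ψ x) * k x = 0) :
    ∀ x ∈ Icc a b, k x = 0 := by
  obtain ⟨M, hM⟩ := isCompact_Icc.exists_bound_of_continuousOn hk
  have hM0 : 0 ≤ M := (norm_nonneg _).trans (hM a (left_mem_Icc.2 hab.le))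
  -- For a polynomial `p` with `p(ψ)` within `ε` of `k`, orthogonality gives `∫ k² = ∫ (k - p(ψ)) k
  -- ≤ ε (M + 1) (b - a)`; `ε` is chosen to make this bound `δ`, and `M + 1` keeps the denominator
  -- nonzero.
  have hsq : ∫ x in a..b, k x * k x = 0 := by
    refine le_antisymm ?_ (intervalIntegral.integral_nonneg hab.le fun x _ => mul_self_nonneg _)
    refine le_of_forall_pos_le_add fun δ hδ => ?_
    set ε : ℝ := δ / ((M + 1) * (b - a)) with hε
    have hba : 0 < b - a := sub_pos.2 hab
    have hε0 : 0 < ε := by positivity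
    let Ψ : C(Icc a b, ℝ) := ⟨fun x => ψ x, hψ.domRestrict⟩
    have hsep : (Algebra.adjoin ℝ {Ψ}).SeparatesPoints := by
      intro x y hxy
      refine ⟨Ψ, ⟨Ψ, Algebra.subset_adjoin rfl, rfl⟩, fun he => hxy ?_⟩
      exact Subtype.ext (hinj x.2 y.2 he)
    obtain ⟨⟨g, hg⟩, hgk⟩ := ContinuousMap.exists_mem_subalgebra_near_continuous_of_separatesPoints
      (Algebra.adjoin ℝ {Ψ}) hsep (fun x => k x) hk.domRestrict ε hε0
    rw [Algebra.adjoin_singleton_eq_range_aeval] at hg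
    obtain ⟨p, rfl⟩ := hg
    have hp : ∀ x ∈ Icc a b, |p.eval (ψ x) - k x| ≤ ε := by
      intro x hx
      have := (hgk ⟨x, hx⟩).le
      rw [Real.norm_eq_abs] at this
      refine le_of_eq_of_le ?_ this
      change _ = |(Polynomial.aeval Ψ p) ⟨x, hx⟩ - k x|
      rw [Polynomial.aeval_continuousMap_apply]
      rfl
    have hkc : ContinuousOn k (uIcc a b) := by rwa [uIcc_of_le hab.le]
    have hpc : ContinuousOn (fun x => p.eval (ψ x)) (uIcc a b) := by
      rw [uIcc_of_le hab.le]; exact p.continuous.comp_continuousOn hψ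
    have hle : ∫ x in a..b, (k x * k x - p.eval (ψ x) * k x) ≤ ∫ _x in a..b, ε * (M + 1) := by
      refine intervalIntegral.integral_mono_on hab.le ?_ (by simp) fun x hx => ?_
      · exact ((hkc.mul hkc).sub (hpc.mul hkc)).intervalIntegrable
      · have h1 := hp x hx
        have h2 := hM x hx
        rw [Real.norm_eq_abs] at h2
        calc k x * k x - p.eval (ψ x) * k x = -((p.eval (ψ x) - k x) * k x) := by ring
          _ ≤ |(p.eval (ψ x) - k x) * k x| := neg_le_abs _
          _ = |p.eval (ψ x) - k x| * |k x| := abs_mul _ _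
          _ ≤ ε * (M + 1) := by gcongr; linarith
    have hsub := intervalIntegral.integral_sub (hkc.mul hkc).intervalIntegrable
      (hpc.mul hkc).intervalIntegrable (μ := volume)
    simp only [Pi.mul_apply] at hsub
    rw [hsub, h p, sub_zero] at hle
    refine hle.trans ?_
    rw [intervalIntegral.integral_const, smul_eq_mul, hε]
    field_simp
    simp
  intro x hx
  exact mul_self_eq_zero.1 (eqOn_zero_of_intervalIntegral_eq_zero hab (hk.mul hk)
    (fun x _ => mul_self_nonneg _) hsq x hx)

/-- The divergence theorem on a rectangle for fields that are `C¹` up to the boundary. -/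
theorem integral_divergence_of_contDiffOn {a b c d : ℝ} (hab : a < b) (hcd : c < d)
    {f g : ℝ × ℝ → ℝ} (hf : ContDiffOn ℝ 1 f (Icc a b ×ˢ Icc c d))
    (hg : ContDiffOn ℝ 1 g (Icc a b ×ˢ Icc c d)) :
    ContinuousOn (fun x => fderivWithin ℝ f (Icc a b ×ˢ Icc c d) x (1, 0) +
        fderivWithin ℝ g (Icc a b ×ˢ Icc c d) x (0, 1)) (Icc a b ×ˢ Icc c d) ∧
    ∫ x in Icc a b ×ˢ Icc c d, (fderivWithin ℝ f (Icc a b ×ˢ Icc c d) x (1, 0) +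
        fderivWithin ℝ g (Icc a b ×ˢ Icc c d) x (0, 1)) =
      (∫ r in a..b, g (r, d)) - (∫ r in a..b, g (r, c)) +
        (∫ t in c..d, f (b, t)) - ∫ t in c..d, f (a, t) := by
  have hu : UniqueDiffOn ℝ (Icc a b ×ˢ Icc c d) :=
    (uniqueDiffOn_Icc hab).prod (uniqueDiffOn_Icc hcd)
  have hcont : ContinuousOn (fun x => fderivWithin ℝ f (Icc a b ×ˢ Icc c d) x (1, 0) +
        fderivWithin ℝ g (Icc a b ×ˢ Icc c d) x (0, 1)) (Icc a b ×ˢ Icc c d) :=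
    ((hf.continuousOn_fderivWithin hu le_rfl).clm_apply continuousOn_const).add
      ((hg.continuousOn_fderivWithin hu le_rfl).clm_apply continuousOn_const)
  refine ⟨hcont, ?_⟩
  have hK : (Icc a b ×ˢ Icc c d : Set (ℝ × ℝ)) = Icc (a, c) (b, d) := Icc_prod_Icc _ _ _ _
  have hmem : ∀ x ∈ Ioo a b ×ˢ Ioo c d, Icc a b ×ˢ Icc c d ∈ nhds x := fun x hx =>
    Filter.mem_of_superset ((isOpen_Ioo.prod isOpen_Ioo).mem_nhds hx)
      (prod_mono Ioo_subset_Icc_self Ioo_subset_Icc_self)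
  have hmain := integral_divergence_prod_Icc_of_hasFDerivAt_off_countable_of_le f g
    (fderivWithin ℝ f (Icc a b ×ˢ Icc c d)) (fderivWithin ℝ g (Icc a b ×ˢ Icc c d))
    (a, c) (b, d) ⟨hab.le, hcd.le⟩ ∅ countable_empty (hK ▸ hf.continuousOn) (hK ▸ hg.continuousOn)
    (fun x hx => ((hf.differentiableOn one_ne_zero x
      (mem_of_mem_nhds (hmem x hx.1))).hasFDerivWithinAt).hasFDerivAt (hmem x hx.1))
    (fun x hx => ((hg.differentiableOn one_ne_zero x
      (mem_of_mem_nhds (hmem x hx.1))).hasFDerivWithinAt).hasFDerivAt (hmem x hx.1))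
    (by
      rw [← hK]
      exact hcont.integrableOn_compact (isCompact_Icc.prod isCompact_Icc))
  rw [← hK] at hmain
  exact hmain

theorem subset_closure_interior_rect {a b c d : ℝ} (hab : a < b) (hcd : c < d) :
    (Icc a b ×ˢ Icc c d : Set (ℝ × ℝ)) ⊆ closure (interior (Icc a b ×ˢ Icc c d)) := by
  rw [interior_prod_eq, closure_prod_eq, closure_interior_Icc hab.ne, closure_interior_Icc hcd.ne]

/-- A continuous function on a rectangle that vanishes inside vanishes up to the boundary. -/
theorem eqOn_rect_of_eqOn_interior {a b c d : ℝ} (hab : a < b) (hcd : c < d) {f : ℝ × ℝ → ℝ}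
    (hf : ContinuousOn f (Icc a b ×ˢ Icc c d)) (h : ∀ x ∈ Ioo a b ×ˢ Ioo c d, f x = 0) :
    ∀ x ∈ Icc a b ×ˢ Icc c d, f x = 0 := by
  have h1 : EqOn f 0 (interior (Icc a b ×ˢ Icc c d)) := by
    rw [interior_prod_eq, interior_Icc, interior_Icc]; exact h
  exact h1.of_subset_closure hf continuousOn_const interior_subset
    (subset_closure_interior_rect hab hcd)

/-- Flux conservation: if `∂_r f + ∂_θ g = 0` and `f` vanishes for `r = a` and `r = b`, then the
flux `∫ g dr` is the same through all rays. -/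
theorem integral_eq_of_divergence_eq_zero {a b c d : ℝ} (hab : a < b)
    {f g : ℝ × ℝ → ℝ} (hf : ContDiffOn ℝ 1 f (Icc a b ×ˢ Icc c d))
    (hg : ContDiffOn ℝ 1 g (Icc a b ×ˢ Icc c d))
    (hdiv : ∀ x ∈ Icc a b ×ˢ Icc c d, fderivWithin ℝ f (Icc a b ×ˢ Icc c d) x (1, 0) +
        fderivWithin ℝ g (Icc a b ×ˢ Icc c d) x (0, 1) = 0)
    (hfa : ∀ t ∈ Icc c d, f (a, t) = 0) (hfb : ∀ t ∈ Icc c d, f (b, t) = 0)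
    {t t' : ℝ} (ht : t ∈ Icc c d) (ht' : t' ∈ Icc c d) :
    ∫ r in a..b, g (r, t) = ∫ r in a..b, g (r, t') := by
  wlog htt : t < t' generalizing t t'
  · rcases (not_lt.1 htt).eq_or_lt with h | h
    · rw [h]
    · exact (this ht' ht h).symm
  have hsub : (Icc a b ×ˢ Icc t t' : Set (ℝ × ℝ)) ⊆ Icc a b ×ˢ Icc c d :=
    prod_mono le_rfl (Icc_subset_Icc ht.1 ht'.2)
  have hu : UniqueDiffOn ℝ (Icc a b ×ˢ Icc t t') :=
    (uniqueDiffOn_Icc hab).prod (uniqueDiffOn_Icc htt)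
  obtain ⟨-, h⟩ := integral_divergence_of_contDiffOn hab htt (hf.mono hsub) (hg.mono hsub)
  have hzero : ∀ r, (∀ s ∈ Icc c d, f (r, s) = 0) → ∫ s in t..t', f (r, s) = 0 := by
    intro r hr
    rw [intervalIntegral.integral_congr (g := fun _ => (0 : ℝ)), intervalIntegral.integral_zero]
    intro s hs
    rw [uIcc_of_le htt.le] at hs
    exact hr s (Icc_subset_Icc ht.1 ht'.2 hs)
  rw [setIntegral_congr_fun (measurableSet_Icc.prod measurableSet_Icc) (g := fun _ => (0 : ℝ)),
    hzero a hfa, hzero b hfb, integral_zero] at h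
  · linarith
  · intro x hx
    -- By unique differentiability, derivatives within the narrower rectangle coincide with those
    -- within the full one.
    have h1 := ((hf.differentiableOn one_ne_zero x (hsub hx)).hasFDerivWithinAt.mono
      hsub).fderivWithin (hu x hx)
    have h2 := ((hg.differentiableOn one_ne_zero x (hsub hx)).hasFDerivWithinAt.mono
      hsub).fderivWithin (hu x hx)
    simp only [h1, h2]
    exact hdiv x (hsub hx)

end SectorEuler

/-! ### Directional derivatives up to the boundary -/

namespace SectorEuler

open MeasureTheory Set

/-- The derivative of `F` within `K` in the direction `v`. -/
noncomputable def dirDeriv (K : Set (ℝ × ℝ)) (v : ℝ × ℝ) (F : ℝ × ℝ → ℝ) (x : ℝ × ℝ) : ℝ :=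
  fderivWithin ℝ F K x v

section Calculus

variable {K : Set (ℝ × ℝ)} {F G : ℝ × ℝ → ℝ} {v w x : ℝ × ℝ}

theorem dirDeriv_mul (hu : UniqueDiffOn ℝ K) (hF : ContDiffOn ℝ 1 F K) (hG : ContDiffOn ℝ 1 G K)
    (hx : x ∈ K) : dirDeriv K v (fun y => F y * G y) x =
      dirDeriv K v F x * G x + F x * dirDeriv K v G x := by
  have := ((hF.differentiableOn one_ne_zero x hx).hasFDerivWithinAt.mul
    (hG.differentiableOn one_ne_zero x hx).hasFDerivWithinAt).fderivWithin (hu x hx)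
  change fderivWithin ℝ (F * G) K x v = _
  rw [this]
  simp [dirDeriv]
  ring

theorem dirDeriv_add (hu : UniqueDiffOn ℝ K) (hF : ContDiffOn ℝ 1 F K) (hG : ContDiffOn ℝ 1 G K)
    (hx : x ∈ K) : dirDeriv K v (fun y => F y + G y) x = dirDeriv K v F x + dirDeriv K v G x := by
  have := ((hF.differentiableOn one_ne_zero x hx).hasFDerivWithinAt.add
    (hG.differentiableOn one_ne_zero x hx).hasFDerivWithinAt).fderivWithin (hu x hx)
  change fderivWithin ℝ (F + G) K x v = _
  rw [this]
  simp [dirDeriv]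

theorem dirDeriv_sub (hu : UniqueDiffOn ℝ K) (hF : ContDiffOn ℝ 1 F K) (hG : ContDiffOn ℝ 1 G K)
    (hx : x ∈ K) : dirDeriv K v (fun y => F y - G y) x = dirDeriv K v F x - dirDeriv K v G x := by
  have := ((hF.differentiableOn one_ne_zero x hx).hasFDerivWithinAt.sub
    (hG.differentiableOn one_ne_zero x hx).hasFDerivWithinAt).fderivWithin (hu x hx)
  change fderivWithin ℝ (F - G) K x v = _
  rw [this]
  simp [dirDeriv]

theorem dirDeriv_fst (hu : UniqueDiffOn ℝ K) (hx : x ∈ K) :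
    dirDeriv K v (fun y => y.1) x = v.1 := by
  rw [dirDeriv, (hasFDerivWithinAt_fst (𝕜 := ℝ) (p := x) (s := K)).fderivWithin (hu x hx)]
  rfl

theorem dirDeriv_const (c : ℝ) : dirDeriv K v (fun _ => c) x = 0 := by
  simp [dirDeriv]

theorem dirDeriv_comp (hu : UniqueDiffOn ℝ K) (hF : ContDiffOn ℝ 1 F K) {h : ℝ → ℝ}
    (hh : ContDiff ℝ 1 h) (hx : x ∈ K) :
    dirDeriv K v (fun y => h (F y)) x = deriv h (F x) * dirDeriv K v F x := by
  have := ((hh.differentiable one_ne_zero (F x)).hasDerivAt.comp_hasFDerivWithinAt x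
    (hF.differentiableOn one_ne_zero x hx).hasFDerivWithinAt).fderivWithin (hu x hx)
  change fderivWithin ℝ (h ∘ F) K x v = _
  rw [this]
  simp [dirDeriv]

theorem dirDeriv_congr (h : EqOn F G K) (hx : x ∈ K) :
    dirDeriv K v F x = dirDeriv K v G x := by
  rw [dirDeriv, dirDeriv, fderivWithin_congr h (h hx)]

theorem contDiffOn_dirDeriv (hu : UniqueDiffOn ℝ K) (hF : ContDiffOn ℝ 2 F K) :
    ContDiffOn ℝ 1 (dirDeriv K v F) K :=
  (hF.fderivWithin hu (by norm_num)).clm_apply contDiffOn_const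

theorem continuousOn_dirDeriv (hu : UniqueDiffOn ℝ K) (hF : ContDiffOn ℝ 1 F K) :
    ContinuousOn (dirDeriv K v F) K :=
  (hF.continuousOn_fderivWithin hu le_rfl).clm_apply continuousOn_const

/-- Both sides are values of the second derivative within `K`, which is symmetric even at boundary
points since these are limits of interior points. -/
theorem dirDeriv_comm (hu : UniqueDiffOn ℝ K) (hK : K ⊆ closure (interior K))
    (hF : ContDiffOn ℝ 2 F K) (hx : x ∈ K) :
    dirDeriv K v (dirDeriv K w F) x = dirDeriv K w (dirDeriv K v F) x := by
  have hd : DifferentiableWithinAt ℝ (fderivWithin ℝ F K) K x :=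
    (hF.fderivWithin hu (m := 1) (by norm_num)).differentiableOn one_ne_zero x hx
  have key : ∀ v w : ℝ × ℝ, dirDeriv K v (dirDeriv K w F) x =
      fderivWithin ℝ (fderivWithin ℝ F K) K x v w := by
    intro v w
    have := (hd.hasFDerivWithinAt.clm_apply (hasFDerivWithinAt_const w x K)).fderivWithin (hu x hx)
    change fderivWithin ℝ (fun y => fderivWithin ℝ F K y w) K x v = _
    rw [this]
    simp
  rw [key, key]
  exact (hF x hx).isSymmSndFDerivWithinAt (by simp) hu (hK hx) hx v w

end Calculus

/-! ### Restriction to rays and arcs -/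

section Sections

variable {a b d : ℝ} {F : ℝ × ℝ → ℝ}

theorem uniqueDiffOn_closedPolar (hab : a < b) (hd : 0 < d) :
    UniqueDiffOn ℝ (closedPolar a b d) :=
  (uniqueDiffOn_Icc hab).prod (uniqueDiffOn_Icc hd)

theorem hasDerivWithinAt_radial_section (hF : ContDiffOn ℝ 1 F (closedPolar a b d)) {r t : ℝ}
    (hr : r ∈ Icc a b) (ht : t ∈ Icc 0 d) :
    HasDerivWithinAt (fun s => F (s, t)) (dirDeriv (closedPolar a b d) (1, 0) F (r, t))
      (Icc a b) r :=
  (hF.differentiableOn one_ne_zero (r, t) ⟨hr, ht⟩).hasFDerivWithinAt.comp_hasDerivWithinAt r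
    ((hasDerivAt_id r).prodMk (hasDerivAt_const r t)).hasDerivWithinAt
    (show MapsTo (fun s => (s, t)) (Icc a b) (closedPolar a b d) from fun _ hs => ⟨hs, ht⟩)

theorem hasDerivWithinAt_angular_section (hF : ContDiffOn ℝ 1 F (closedPolar a b d)) {r t : ℝ}
    (hr : r ∈ Icc a b) (ht : t ∈ Icc 0 d) :
    HasDerivWithinAt (fun s => F (r, s)) (dirDeriv (closedPolar a b d) (0, 1) F (r, t))
      (Icc 0 d) t :=
  (hF.differentiableOn one_ne_zero (r, t) ⟨hr, ht⟩).hasFDerivWithinAt.comp_hasDerivWithinAt t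
    ((hasDerivAt_const t r).prodMk (hasDerivAt_id t)).hasDerivWithinAt
    (show MapsTo (fun s => (r, s)) (Icc 0 d) (closedPolar a b d) from fun _ hs => ⟨hr, hs⟩)

theorem dirDeriv_radial_eq_of_section_eq (hab : a < b) {G : ℝ × ℝ → ℝ}
    (hF : ContDiffOn ℝ 1 F (closedPolar a b d)) (hG : ContDiffOn ℝ 1 G (closedPolar a b d))
    {t t' : ℝ} (ht : t ∈ Icc 0 d) (ht' : t' ∈ Icc 0 d)
    (h : ∀ r ∈ Icc a b, F (r, t) = G (r, t')) {r : ℝ} (hr : r ∈ Icc a b) :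
    dirDeriv (closedPolar a b d) (1, 0) F (r, t) =
      dirDeriv (closedPolar a b d) (1, 0) G (r, t') :=
  (uniqueDiffOn_Icc hab r hr).eq_deriv _ (hasDerivWithinAt_radial_section hF hr ht)
    ((hasDerivWithinAt_radial_section hG hr ht').congr h (h r hr))

/-- A function on `[x, y]` with vanishing derivative is constant. -/
theorem eq_of_hasDerivWithinAt_zero {x y : ℝ} {f : ℝ → ℝ}
    (hf : ∀ s ∈ Icc x y, HasDerivWithinAt f 0 (Icc x y) s) {s s' : ℝ} (hs : s ∈ Icc x y)
    (hs' : s' ∈ Icc x y) : f s = f s' := by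
  have := (convex_Icc x y).norm_image_sub_le_of_norm_hasDerivWithin_le (C := 0) hf (by simp) hs' hs
  simpa [sub_eq_zero] using this

end Sections

/-- The vorticity of the planar field with polar components `W` (radial) and `V` (angular). -/
noncomputable def polarVorticity (K : Set (ℝ × ℝ)) (W V : ℝ × ℝ → ℝ) (x : ℝ × ℝ) : ℝ :=
  dirDeriv K (1, 0) V x + (V x - dirDeriv K (0, 1) W x) / x.1

/-- A nonstagnant incompressible flow in a truncated sector, in polar components, that transports
its vorticity and does not cross the arcs. -/
structure PolarFlow (a b d : ℝ) (W V : ℝ × ℝ → ℝ) : Prop where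
  pos : 0 < a
  lt : a < b
  angle_pos : 0 < d
  contDiffOn_radial : ContDiffOn ℝ 2 W (closedPolar a b d)
  contDiffOn_angular : ContDiffOn ℝ 2 V (closedPolar a b d)
  angular_ne_zero : ∀ x ∈ closedPolar a b d, V x ≠ 0
  divergence_eq_zero : ∀ x ∈ closedPolar a b d, W x + x.1 * dirDeriv (closedPolar a b d) (1, 0) W x
    + dirDeriv (closedPolar a b d) (0, 1) V x = 0
  transport_vorticity : ∀ x ∈ closedPolar a b d,
    x.1 * W x * dirDeriv (closedPolar a b d) (1, 0) (polarVorticity (closedPolar a b d) W V) x +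
      V x * dirDeriv (closedPolar a b d) (0, 1) (polarVorticity (closedPolar a b d) W V) x = 0
  radial_inner : ∀ t ∈ Icc 0 d, W (a, t) = 0
  radial_outer : ∀ t ∈ Icc 0 d, W (b, t) = 0

theorem contDiffOn_polarVorticity {a b d : ℝ} {W V : ℝ × ℝ → ℝ} (ha : 0 < a) (hab : a < b)
    (hd : 0 < d) (hW : ContDiffOn ℝ 2 W (closedPolar a b d))
    (hV : ContDiffOn ℝ 2 V (closedPolar a b d)) :
    ContDiffOn ℝ 1 (polarVorticity (closedPolar a b d) W V) (closedPolar a b d) := by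
  have hu := uniqueDiffOn_closedPolar hab hd
  refine (contDiffOn_dirDeriv hu hV).add
    (((hV.of_le (by norm_num)).sub (contDiffOn_dirDeriv hu hW)).div contDiff_fst.contDiffOn ?_)
  exact fun x hx => (ha.trans_le hx.1.1).ne'

/-! ### Differentiated vorticity and divergence relations -/

section Identities

variable {a b d : ℝ} {W V : ℝ × ℝ → ℝ} {x : ℝ × ℝ}

theorem polarVorticity_mul {K : Set (ℝ × ℝ)} (hx : x.1 ≠ 0) : polarVorticity K W V x * x.1 =
    x.1 * dirDeriv K (1, 0) V x + (V x - dirDeriv K (0, 1) W x) := by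
  rw [polarVorticity]
  field_simp

/-- Differentiating `r ω` instead of `ω` avoids the quotient: only the Leibniz rule is needed, and
the terms with `v.1` come from the factor `r`. -/
theorem dirDeriv_polarVorticity_mul (ha : 0 < a) (hab : a < b) (hd : 0 < d)
    (hW2 : ContDiffOn ℝ 2 W (closedPolar a b d)) (hV2 : ContDiffOn ℝ 2 V (closedPolar a b d))
    (hx : x ∈ closedPolar a b d) (v : ℝ × ℝ) :
    dirDeriv (closedPolar a b d) v (polarVorticity (closedPolar a b d) W V) x * x.1 +
        polarVorticity (closedPolar a b d) W V x * v.1 =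
      v.1 * dirDeriv (closedPolar a b d) (1, 0) V x +
        x.1 * dirDeriv (closedPolar a b d) v (dirDeriv (closedPolar a b d) (1, 0) V) x +
        (dirDeriv (closedPolar a b d) v V x -
          dirDeriv (closedPolar a b d) v (dirDeriv (closedPolar a b d) (0, 1) W) x) := by
  have hu := uniqueDiffOn_closedPolar hab hd
  have hfst : ContDiffOn ℝ 1 (fun x : ℝ × ℝ => x.1) (closedPolar a b d) := contDiff_fst.contDiffOn
  have hV : ContDiffOn ℝ 1 V (closedPolar a b d) := hV2.of_le (by norm_num)
  have hVr := contDiffOn_dirDeriv (v := (1, 0)) hu hV2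
  have hWt := contDiffOn_dirDeriv (v := (0, 1)) hu hW2
  have := dirDeriv_congr (v := v) (K := closedPolar a b d)
    (fun y hy => polarVorticity_mul (K := closedPolar a b d) (W := W) (V := V)
      (ha.trans_le hy.1.1).ne') hx
  rwa [dirDeriv_mul hu (contDiffOn_polarVorticity ha hab hd hW2 hV2) hfst hx,
    dirDeriv_add hu (hfst.mul hVr) (hV.sub hWt) hx, dirDeriv_mul hu hfst hVr hx,
    dirDeriv_sub hu hV hWt hx, dirDeriv_fst hu hx] at this

theorem dirDeriv_divergence_eq_zero (hab : a < b) (hd : 0 < d)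
    (hW2 : ContDiffOn ℝ 2 W (closedPolar a b d)) (hV2 : ContDiffOn ℝ 2 V (closedPolar a b d))
    (hdiv : ∀ x ∈ closedPolar a b d, W x + x.1 * dirDeriv (closedPolar a b d) (1, 0) W x
      + dirDeriv (closedPolar a b d) (0, 1) V x = 0)
    (hx : x ∈ closedPolar a b d) (v : ℝ × ℝ) :
    dirDeriv (closedPolar a b d) v W x + (v.1 * dirDeriv (closedPolar a b d) (1, 0) W x +
        x.1 * dirDeriv (closedPolar a b d) v (dirDeriv (closedPolar a b d) (1, 0) W) x) +
      dirDeriv (closedPolar a b d) v (dirDeriv (closedPolar a b d) (0, 1) V) x = 0 := by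
  have hu := uniqueDiffOn_closedPolar hab hd
  have hfst : ContDiffOn ℝ 1 (fun x : ℝ × ℝ => x.1) (closedPolar a b d) := contDiff_fst.contDiffOn
  have hW : ContDiffOn ℝ 1 W (closedPolar a b d) := hW2.of_le (by norm_num)
  have hWr := contDiffOn_dirDeriv (v := (1, 0)) hu hW2
  have hVt := contDiffOn_dirDeriv (v := (0, 1)) hu hV2
  have := dirDeriv_congr (v := v) hdiv hx
  rwa [dirDeriv_add hu (hW.add (hfst.mul hWr)) hVt hx, dirDeriv_add hu hW (hfst.mul hWr) hx,
    dirDeriv_mul hu hfst hWr hx, dirDeriv_fst hu hx, dirDeriv_const] at this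

end Identities

/-! ### Conserved fluxes, the stream function and rigidity -/

namespace PolarFlow

variable {a b d : ℝ} {W V : ℝ × ℝ → ℝ} (h : PolarFlow a b d W V)
include h

theorem uniqueDiffOn : UniqueDiffOn ℝ (closedPolar a b d) :=
  uniqueDiffOn_closedPolar h.lt h.angle_pos

theorem radius_pos {x : ℝ × ℝ} (hx : x ∈ closedPolar a b d) : 0 < x.1 :=
  h.pos.trans_le hx.1.1

theorem contDiffOn_one_radial : ContDiffOn ℝ 1 W (closedPolar a b d) :=
  h.contDiffOn_radial.of_le (by norm_num)

theorem contDiffOn_one_angular : ContDiffOn ℝ 1 V (closedPolar a b d) :=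
  h.contDiffOn_angular.of_le (by norm_num)

theorem contDiffOn_vorticity :
    ContDiffOn ℝ 1 (polarVorticity (closedPolar a b d) W V) (closedPolar a b d) :=
  contDiffOn_polarVorticity h.pos h.lt h.angle_pos h.contDiffOn_radial h.contDiffOn_angular

/-- The flux of a transported quantity is the same through all rays. -/
theorem integral_transported {φ : ℝ × ℝ → ℝ} (hφ : ContDiffOn ℝ 1 φ (closedPolar a b d))
    (ht : ∀ x ∈ closedPolar a b d, x.1 * W x * dirDeriv (closedPolar a b d) (1, 0) φ x +
      V x * dirDeriv (closedPolar a b d) (0, 1) φ x = 0)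
    {t t' : ℝ} (hmt : t ∈ Icc 0 d) (hmt' : t' ∈ Icc 0 d) :
    ∫ r in a..b, φ (r, t) * V (r, t) = ∫ r in a..b, φ (r, t') * V (r, t') := by
  have hu := h.uniqueDiffOn
  have hfst : ContDiffOn ℝ 1 (fun x : ℝ × ℝ => x.1) (closedPolar a b d) := contDiff_fst.contDiffOn
  have hW := h.contDiffOn_one_radial
  have hV := h.contDiffOn_one_angular
  refine integral_eq_of_divergence_eq_zero h.lt (c := 0) (d := d)
    (f := fun x => φ x * (x.1 * W x)) (g := fun x => φ x * V x) (hφ.mul (hfst.mul hW))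
    (hφ.mul hV) ?_ ?_ ?_ hmt hmt'
  · intro x hx
    change dirDeriv (closedPolar a b d) (1, 0) _ x + dirDeriv (closedPolar a b d) (0, 1) _ x = 0
    rw [dirDeriv_mul hu hφ (hfst.mul hW) hx, dirDeriv_mul hu hφ hV hx,
      dirDeriv_mul hu hfst hW hx, dirDeriv_fst hu hx]
    -- The divergence of `(φ r W, φ V)` is the transport expression of `φ` plus `φ` times the
    -- incompressibility expression.
    linear_combination ht x hx + φ x * h.divergence_eq_zero x hx
  · intro t ht
    simp [h.radial_inner t ht]
  · intro t ht
    simp [h.radial_outer t ht]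

/-- The angular flux is the same through all rays. -/
theorem integral_angular {t t' : ℝ} (ht : t ∈ Icc 0 d) (ht' : t' ∈ Icc 0 d) :
    ∫ r in a..b, V (r, t) = ∫ r in a..b, V (r, t') := by
  simpa using h.integral_transported (φ := fun _ => 1) contDiffOn_const
    (fun x _ => by simp [dirDeriv_const]) ht ht'

/-- The sign of the vorticity relative to the angular velocity propagates from a ray. -/
theorem vorticity_mul_nonpos {c t : ℝ} (hc : ∀ x ∈ closedPolar a b d, 0 < c * V x)
    (ht : t ∈ Icc 0 d)
    (hs : ∀ r ∈ Icc a b, c * polarVorticity (closedPolar a b d) W V (r, t) ≤ 0) :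
    ∀ x ∈ closedPolar a b d, c * polarVorticity (closedPolar a b d) W V x ≤ 0 := by
  have hu := h.uniqueDiffOn
  have hcω : ContDiffOn ℝ 1 (fun x => c * polarVorticity (closedPolar a b d) W V x)
    (closedPolar a b d) := contDiffOn_const.mul h.contDiffOn_vorticity
  -- `expNegInvGlue` is smooth, zero on `(-∞, 0]` and positive elsewhere, so its flux detects
  -- positive values of `c ω`. The flux vanishes on the given ray, hence on all; as `c V > 0`, the
  -- integrand must vanish as well.
  have hφ : ContDiffOn ℝ 1
      (fun x => expNegInvGlue (c * polarVorticity (closedPolar a b d) W V x))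
      (closedPolar a b d) := (expNegInvGlue.contDiff (n := 1)).comp_contDiffOn hcω
  rintro ⟨r, t'⟩ ⟨hr, ht'⟩
  have hflux := h.integral_transported hφ (fun x hx => by
    rw [dirDeriv_comp hu hcω expNegInvGlue.contDiff hx,
      dirDeriv_comp hu hcω expNegInvGlue.contDiff hx,
      dirDeriv_mul hu contDiffOn_const h.contDiffOn_vorticity hx,
      dirDeriv_mul hu contDiffOn_const h.contDiffOn_vorticity hx, dirDeriv_const, dirDeriv_const]
    linear_combination deriv expNegInvGlue (c * polarVorticity (closedPolar a b d) W V x) * c *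
      h.transport_vorticity x hx) ht' ht
  have hz : ∫ r in a..b, expNegInvGlue (c * polarVorticity (closedPolar a b d) W V (r, t)) *
      V (r, t) = 0 := by
    rw [intervalIntegral.integral_congr (g := fun _ => (0 : ℝ)), intervalIntegral.integral_zero]
    intro r hr
    rw [uIcc_of_le h.lt.le] at hr
    simp [expNegInvGlue.zero_of_nonpos (hs r hr)]
  rw [hz] at hflux
  have hcomp : ContinuousOn (fun r : ℝ => (r, t')) (Icc a b) := by fun_prop
  have hmaps : MapsTo (fun r : ℝ => (r, t')) (Icc a b) (closedPolar a b d) :=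
    fun r hr => ⟨hr, ht'⟩
  have hzero := eqOn_zero_of_intervalIntegral_eq_zero h.lt
    (f := fun r => c * (expNegInvGlue (c * polarVorticity (closedPolar a b d) W V (r, t')) *
      V (r, t')))
    (continuousOn_const.mul ((hφ.continuousOn.comp hcomp hmaps).mul
      (h.contDiffOn_angular.continuousOn.comp hcomp hmaps)))
    (fun r hr => by
      have := mul_nonneg (expNegInvGlue.nonneg
        (c * polarVorticity (closedPolar a b d) W V (r, t'))) (hc (r, t') ⟨hr, ht'⟩).le
      linarith)
    (by rw [intervalIntegral.integral_const_mul, hflux, mul_zero]) r hr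
  have hcV := hc (r, t') ⟨hr, ht'⟩
  have hc0 : c ≠ 0 := by rintro rfl; simp at hcV
  rw [mul_eq_zero, mul_eq_zero] at hzero
  rcases hzero with h1 | h1 | h1
  · exact absurd h1 hc0
  · exact expNegInvGlue.zero_iff_nonpos.1 h1
  · exact absurd h1 (h.angular_ne_zero _ ⟨hr, ht'⟩)

/-- Existence of a stream function up to the boundary. -/
theorem exists_streamFunction : ∃ ψ : ℝ × ℝ → ℝ, ContDiffOn ℝ 1 ψ (closedPolar a b d) ∧
    ∀ x ∈ closedPolar a b d, dirDeriv (closedPolar a b d) (1, 0) ψ x = V x ∧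
      dirDeriv (closedPolar a b d) (0, 1) ψ x = -(x.1 * W x) := by
  have hu := h.uniqueDiffOn
  have hW := h.contDiffOn_one_radial
  have hV := h.contDiffOn_one_angular
  have hfst : ContDiffOn ℝ 1 (fun x : ℝ × ℝ => x.1) (closedPolar a b d) := contDiff_fst.contDiffOn
  -- The form `η = V dr - r W dθ` is closed exactly by incompressibility; the Poincaré lemma on the
  -- convex rectangle supplies a primitive.
  set η : ℝ × ℝ → ℝ × ℝ →L[ℝ] ℝ := fun x =>
    V x • ContinuousLinearMap.fst ℝ ℝ ℝ - (x.1 * W x) • ContinuousLinearMap.snd ℝ ℝ ℝ with hη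
  have hηc : ContDiffOn ℝ 1 η (closedPolar a b d) :=
    (hV.smul contDiffOn_const).sub ((hfst.mul hW).smul contDiffOn_const)
  have hconv : Convex ℝ (closedPolar a b d) := (convex_Icc a b).prod (convex_Icc 0 d)
  have hval : ∀ x ∈ closedPolar a b d, ∀ v w : ℝ × ℝ,
      fderivWithin ℝ η (closedPolar a b d) x v w = dirDeriv (closedPolar a b d) v V x * w.1 -
        (v.1 * W x + x.1 * dirDeriv (closedPolar a b d) v W x) * w.2 := by
    intro x hx v w
    have h1 : dirDeriv (closedPolar a b d) v (fun y => η y w) x =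
        fderivWithin ℝ η (closedPolar a b d) x v w := by
      rw [dirDeriv, ((hηc.differentiableOn one_ne_zero x hx).hasFDerivWithinAt.clm_apply
        (hasFDerivWithinAt_const w x _)).fderivWithin (hu x hx)]
      simp
    have h2 : (fun y => η y w) = fun y => V y * w.1 - y.1 * W y * w.2 := by
      funext y; simp [hη]
    rw [← h1, h2, dirDeriv_sub hu (hV.mul contDiffOn_const) ((hfst.mul hW).mul contDiffOn_const) hx,
      dirDeriv_mul hu hV contDiffOn_const hx, dirDeriv_mul hu (hfst.mul hW) contDiffOn_const hx,
      dirDeriv_mul hu hfst hW hx, dirDeriv_fst hu hx, dirDeriv_const, dirDeriv_const]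
    ring
  obtain ⟨ψ, hψ⟩ := hconv.exists_forall_hasFDerivWithinAt_of_fderivWithin_symmetric
    (hηc.differentiableOn one_ne_zero) (fun x hx v _ w _ => by
      have hlin : ∀ F : ℝ × ℝ → ℝ, ∀ v : ℝ × ℝ, dirDeriv (closedPolar a b d) v F x =
          v.1 * dirDeriv (closedPolar a b d) (1, 0) F x +
            v.2 * dirDeriv (closedPolar a b d) (0, 1) F x := by
        intro F v
        have hv : v = v.1 • ((1, 0) : ℝ × ℝ) + v.2 • ((0, 1) : ℝ × ℝ) := by
          ext <;> simp
        simp only [dirDeriv]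
        conv_lhs => rw [hv]
        rw [map_add, map_smul, map_smul, smul_eq_mul, smul_eq_mul]
      rw [hval x hx, hval x hx, hlin V v, hlin V w, hlin W v, hlin W w]
      linear_combination (v.2 * w.1 - w.2 * v.1) * h.divergence_eq_zero x hx)
  have hd : ∀ x ∈ closedPolar a b d, fderivWithin ℝ ψ (closedPolar a b d) x = η x :=
    fun x hx => (hψ x hx).fderivWithin (hu x hx)
  refine ⟨ψ, ?_, fun x hx => ?_⟩
  · rw [show (1 : WithTop ℕ∞) = 0 + 1 by norm_num, contDiffOn_succ_iff_fderivWithin hu]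
    refine ⟨fun x hx => (hψ x hx).differentiableWithinAt, by simp, ?_⟩
    exact (hηc.of_le (by norm_num)).congr hd
  · simp [dirDeriv, hd x hx, hη]

/-- If the velocity agrees on the two edges then so does the vorticity. -/
theorem vorticity_edge_eq
    (hVe : ∀ r ∈ Icc a b, V (r, 0) = V (r, d)) :
    ∀ r ∈ Icc a b, polarVorticity (closedPolar a b d) W V (r, 0) =
      polarVorticity (closedPolar a b d) W V (r, d) := by
  have hu := h.uniqueDiffOn
  have h0 : (0 : ℝ) ∈ Icc 0 d := left_mem_Icc.2 h.angle_pos.le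
  have hd : d ∈ Icc 0 d := right_mem_Icc.2 h.angle_pos.le
  have ha : a ∈ Icc a b := left_mem_Icc.2 h.lt.le
  obtain ⟨ψ, hψ, hψ'⟩ := h.exists_streamFunction
  -- The inner arc is a streamline because `W = 0` there. From this common value, `ψ` grows at the
  -- same rate `V` along both edges.
  have hψa : ψ (a, 0) = ψ (a, d) := by
    refine eq_of_hasDerivWithinAt_zero (f := fun s => ψ (a, s)) (fun s hs => ?_) h0 hd
    have := hasDerivWithinAt_angular_section hψ ha hs
    rwa [(hψ' (a, s) ⟨ha, hs⟩).2, h.radial_inner s hs, mul_zero, neg_zero] at this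
  have hψe : ∀ r ∈ Icc a b, ψ (r, 0) = ψ (r, d) := by
    intro r hr
    have := eq_of_hasDerivWithinAt_zero (f := fun s => ψ (s, 0) - ψ (s, d)) (fun s hs => ?_) hr ha
    · linarith
    · have := (hasDerivWithinAt_radial_section hψ hs h0).sub
        (hasDerivWithinAt_radial_section hψ hs hd)
      rwa [(hψ' (s, 0) ⟨hs, h0⟩).1, (hψ' (s, d) ⟨hs, hd⟩).1, hVe s hs, sub_self] at this
  -- By Rolle, a repeated value of `ψ` along the edge would force a zero of `V = ψ_r`.
  have hinj : InjOn (fun r => ψ (r, 0)) (Icc a b) := by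
    intro r hr s hs hrs
    by_contra hne
    wlog hlt : r < s generalizing r s
    · exact this hs hr hrs.symm (Ne.symm hne) (lt_of_le_of_ne (not_lt.1 hlt) (Ne.symm hne))
    have hcont : ContinuousOn (fun r => ψ (r, 0)) (Icc r s) := fun q hq =>
      ((hasDerivWithinAt_radial_section hψ (Icc_subset_Icc hr.1 hs.2 hq) h0).continuousWithinAt).mono
        (Icc_subset_Icc hr.1 hs.2)
    obtain ⟨q, hq, hq0⟩ := exists_hasDerivAt_eq_zero hlt hcont hrs
      (f' := fun q => V (q, 0)) (fun q hq => by
        have hqab : q ∈ Ioo a b := ⟨hr.1.trans_lt hq.1, hq.2.trans_le hs.2⟩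
        have := (hasDerivWithinAt_radial_section hψ (Ioo_subset_Icc_self hqab) h0).hasDerivAt
          (Icc_mem_nhds hqab.1 hqab.2)
        rwa [(hψ' (q, 0) ⟨Ioo_subset_Icc_self hqab, h0⟩).1] at this)
    exact h.angular_ne_zero (q, 0)
      ⟨⟨hr.1.trans hq.1.le, hq.2.le.trans hs.2⟩, h0⟩ hq0
  have hcomp : ∀ t : ℝ, ContinuousOn (fun r : ℝ => (r, t)) (Icc a b) := by intro t; fun_prop
  have hmaps : ∀ t ∈ Icc 0 d, MapsTo (fun r : ℝ => (r, t)) (Icc a b) (closedPolar a b d) :=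
    fun t ht r hr => ⟨hr, ht⟩
  have hωc : ∀ t ∈ Icc 0 d, ContinuousOn
      (fun r => polarVorticity (closedPolar a b d) W V (r, t) * V (r, t)) (Icc a b) := fun t ht =>
    ((h.contDiffOn_vorticity.continuousOn.comp (hcomp t) (hmaps t ht)).mul
      (h.contDiffOn_angular.continuousOn.comp (hcomp t) (hmaps t ht)))
  have hψc : ContinuousOn (fun r => ψ (r, 0)) (Icc a b) :=
    hψ.continuousOn.comp (hcomp 0) (hmaps 0 h0)
  have hzero := eqOn_zero_of_forall_polynomial_integral_eq_zero h.lt hψc hinj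
    ((hωc 0 h0).sub (hωc d hd)) (fun p => by
      have hpd : ContDiff ℝ 1 (fun y => p.eval y) := by
        simpa [Polynomial.coe_aeval_eq_eval] using p.contDiff_aeval (𝕜 := ℝ) 1
      have hp : ContDiffOn ℝ 1 (fun x => p.eval (ψ x)) (closedPolar a b d) :=
        hpd.comp_contDiffOn hψ
      -- Since `ψ_r = V` and `ψ_θ = -r W`, the transport expression of `ψ` is identically zero;
      -- hence `p(ψ) ω` is transported along with `ω`.
      have hflux := h.integral_transported (hp.mul h.contDiffOn_vorticity) (fun x hx => by
        change x.1 * W x * dirDeriv _ _ (fun y => p.eval (ψ y) * polarVorticity _ W V y) x +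
          V x * dirDeriv _ _ (fun y => p.eval (ψ y) * polarVorticity _ W V y) x = 0
        rw [dirDeriv_mul hu hp h.contDiffOn_vorticity hx,
          dirDeriv_mul hu hp h.contDiffOn_vorticity hx,
          dirDeriv_comp hu hψ hpd hx, dirDeriv_comp hu hψ hpd hx,
          (hψ' x hx).1, (hψ' x hx).2]
        linear_combination p.eval (ψ x) * h.transport_vorticity x hx) h0 hd
      have hpc : ∀ t ∈ Icc 0 d, IntervalIntegrable (fun r => p.eval (ψ (r, 0)) *
          (polarVorticity (closedPolar a b d) W V (r, t) * V (r, t))) volume a b := fun t ht =>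
        ContinuousOn.intervalIntegrable_of_Icc h.lt.le
          ((p.continuous.comp_continuousOn hψc).mul (hωc t ht))
      have hsub := intervalIntegral.integral_sub (hpc 0 h0) (hpc d hd)
      calc _ = _ := intervalIntegral.integral_congr (fun r _ => mul_sub _ _ _)
        _ = _ := hsub
        _ = 0 := by
          rw [sub_eq_zero]
          calc _ = _ := intervalIntegral.integral_congr (fun r _ => (mul_assoc _ _ _).symm)
            _ = _ := hflux
            _ = _ := intervalIntegral.integral_congr (fun r hr => by
              rw [uIcc_of_le h.lt.le] at hr
              rw [hψe r hr, mul_assoc]))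
  intro r hr
  have : polarVorticity (closedPolar a b d) W V (r, 0) * V (r, 0) -
    polarVorticity (closedPolar a b d) W V (r, d) * V (r, d) = 0 := hzero r hr
  rw [hVe r hr, ← sub_mul, mul_eq_zero, sub_eq_zero] at this
  exact this.resolve_right (h.angular_ne_zero (r, d) ⟨hr, hd⟩)

/-- If the velocity agrees on the two edges and the vorticity has the sign opposite to the angular
velocity, then the flow is circular. -/
theorem radial_eq_zero {c : ℝ} (hc : ∀ x ∈ closedPolar a b d, 0 < c * V x)
    (hω : ∀ x ∈ closedPolar a b d, c * polarVorticity (closedPolar a b d) W V x ≤ 0)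
    (hVe : ∀ r ∈ Icc a b, V (r, 0) = V (r, d)) (hWe : ∀ r ∈ Icc a b, W (r, 0) = W (r, d)) :
    ∀ x ∈ closedPolar a b d, W x = 0 := by
  have hu := h.uniqueDiffOn
  have hcl : closedPolar a b d ⊆ closure (interior (closedPolar a b d)) :=
    subset_closure_interior_rect h.lt h.angle_pos
  have hW2 := h.contDiffOn_radial
  have hV2 := h.contDiffOn_angular
  have hW := h.contDiffOn_one_radial
  have hV := h.contDiffOn_one_angular
  have hWr : ContDiffOn ℝ 1 (dirDeriv (closedPolar a b d) (1, 0) W) (closedPolar a b d) :=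
    contDiffOn_dirDeriv hu hW2
  have hWt : ContDiffOn ℝ 1 (dirDeriv (closedPolar a b d) (0, 1) W) (closedPolar a b d) :=
    contDiffOn_dirDeriv hu hW2
  have hVr : ContDiffOn ℝ 1 (dirDeriv (closedPolar a b d) (1, 0) V) (closedPolar a b d) :=
    contDiffOn_dirDeriv hu hV2
  have hVt : ContDiffOn ℝ 1 (dirDeriv (closedPolar a b d) (0, 1) V) (closedPolar a b d) :=
    contDiffOn_dirDeriv hu hV2
  have hfst : ContDiffOn ℝ 1 (fun x : ℝ × ℝ => x.1) (closedPolar a b d) := contDiff_fst.contDiffOn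
  have hωc := h.contDiffOn_vorticity
  set K := closedPolar a b d with hK
  set ω := polarVorticity K W V with hωdef
  have hp : ContDiffOn ℝ 1 (fun x => W x / V x) K := hW.div hV h.angular_ne_zero
  have hA0 := (hV.mul hWr).sub (hW.mul hVr)
  have hB0 := (hV.mul hWt).sub (hW.mul hVt)
  have hA := (hfst.mul (hfst.mul hfst)).mul hA0
  have hB := hfst.mul hB0
  have h0 : (0 : ℝ) ∈ Icc 0 d := left_mem_Icc.2 h.angle_pos.le
  have hd : d ∈ Icc 0 d := right_mem_Icc.2 h.angle_pos.le
  have hωmul : ∀ x ∈ K, ω x * x.1 =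
      x.1 * dirDeriv K (1, 0) V x + (V x - dirDeriv K (0, 1) W x) :=
    fun x hx => polarVorticity_mul (h.radius_pos hx).ne'
  have hquot : ∀ x ∈ K, ∀ v, V x ^ 2 * dirDeriv K v (fun x => W x / V x) x =
      V x * dirDeriv K v W x - W x * dirDeriv K v V x := by
    intro x hx v
    have h1 : dirDeriv K v W x = dirDeriv K v (fun x => W x / V x * V x) x :=
      dirDeriv_congr (fun y hy => (div_mul_cancel₀ _ (h.angular_ne_zero y hy)).symm) hx
    rw [dirDeriv_mul hu hp hV hx] at h1
    have hV0 := h.angular_ne_zero x hx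
    rw [h1]
    field_simp
    ring
  -- The energy identity: the product rule for `p` times the field `(r³ V² p_r, r V² p_θ)`, written
  -- with `V² p_v = V W_v - W V_v` so that no derivative of a quotient is differentiated again.
  have hdiv : ∀ x ∈ K, dirDeriv K (1, 0) (fun x => W x / V x * (x.1 * (x.1 * x.1) *
        (V x * dirDeriv K (1, 0) W x - W x * dirDeriv K (1, 0) V x))) x +
      dirDeriv K (0, 1) (fun x => W x / V x * (x.1 *
        (V x * dirDeriv K (0, 1) W x - W x * dirDeriv K (0, 1) V x))) x =
      x.1 ^ 3 * V x ^ 2 * dirDeriv K (1, 0) (fun x => W x / V x) x ^ 2 +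
      x.1 * V x ^ 2 * dirDeriv K (0, 1) (fun x => W x / V x) x ^ 2 -
      2 * W x ^ 2 * x.1 ^ 2 * (ω x / V x) := by
    intro x hx
    have hr := h.radius_pos hx
    have hωv := dirDeriv_polarVorticity_mul h.pos h.lt h.angle_pos hW2 hV2 hx
    have hdv := dirDeriv_divergence_eq_zero h.lt h.angle_pos hW2 hV2 h.divergence_eq_zero hx
    have e1 := hωv (1, 0)
    have e2 := hωv (0, 1)
    have e3 := hdv (1, 0)
    have e4 := hdv (0, 1)
    have e5 := h.transport_vorticity x hx
    have e6 := hωmul x hx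
    have e7 := h.divergence_eq_zero x hx
    have q1 := hquot x hx (1, 0)
    have q2 := hquot x hx (0, 1)
    have c1 := dirDeriv_comm (v := (1, 0)) (w := (0, 1)) hu hcl hV2 hx
    have c2 := dirDeriv_comm (v := (1, 0)) (w := (0, 1)) hu hcl hW2 hx
    rw [dirDeriv_mul hu hp hA hx, dirDeriv_mul hu hp hB hx,
      dirDeriv_mul hu (hfst.mul (hfst.mul hfst)) hA0 hx, dirDeriv_mul hu hfst hB0 hx,
      dirDeriv_mul hu hfst (hfst.mul hfst) hx, dirDeriv_mul hu hfst hfst hx,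
      dirDeriv_sub hu (hV.mul hWr) (hW.mul hVr) hx, dirDeriv_sub hu (hV.mul hWt) (hW.mul hVt) hx,
      dirDeriv_mul hu hV hWr hx, dirDeriv_mul hu hW hVr hx, dirDeriv_mul hu hV hWt hx,
      dirDeriv_mul hu hW hVt hx, dirDeriv_fst hu hx, dirDeriv_fst hu hx]
    have hV0 := h.angular_ne_zero x hx
    simp only [mul_one, one_mul, mul_zero, zero_mul, add_zero, zero_add] at e1 e2 e3 e4 ⊢
    -- The differentiated divergence and vorticity relations, with commuting mixed derivatives,
    -- reduce the second-order terms to derivatives of `ω`; these occur only as the transport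
    -- expression, which is zero.
    have hdivfree : 3 * x.1 ^ 2 * (V x * dirDeriv K (1, 0) W x - W x * dirDeriv K (1, 0) V x) +
        x.1 ^ 3 * (V x * dirDeriv K (1, 0) (dirDeriv K (1, 0) W) x -
          W x * dirDeriv K (1, 0) (dirDeriv K (1, 0) V) x) +
        x.1 * (V x * dirDeriv K (0, 1) (dirDeriv K (0, 1) W) x -
          W x * dirDeriv K (0, 1) (dirDeriv K (0, 1) V) x) = -2 * W x * x.1 ^ 2 * ω x := by
      linear_combination x.1 ^ 2 * V x * e3 - x.1 * W x * e4 + x.1 * V x * e7 + x.1 * W x * e6 -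
        x.1 * (x.1 * e5 - x.1 * W x * e1 - V x * e2) - x.1 ^ 2 * V x * c1 - x.1 ^ 2 * W x * c2
    linear_combination (W x / V x) * hdivfree -
      x.1 ^ 3 * dirDeriv K (1, 0) (fun x => W x / V x) x * q1 -
      x.1 * dirDeriv K (0, 1) (fun x => W x / V x) x * q2
  have hsign : ∀ x ∈ K, ω x / V x ≤ 0 := by
    intro x hx
    have hc0 : c ≠ 0 := by
      rintro rfl
      simpa using hc x hx
    rw [← mul_div_mul_left _ _ hc0]
    exact div_nonpos_of_nonpos_of_nonneg (hω x hx) (hc x hx).le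
  have hterm : ∀ x ∈ K, 0 ≤ x.1 ^ 3 * V x ^ 2 * dirDeriv K (1, 0) (fun x => W x / V x) x ^ 2 ∧
      0 ≤ x.1 * V x ^ 2 * dirDeriv K (0, 1) (fun x => W x / V x) x ^ 2 ∧
      2 * W x ^ 2 * x.1 ^ 2 * (ω x / V x) ≤ 0 := by
    intro x hx
    have hr := h.radius_pos hx
    exact ⟨by positivity, by positivity,
      mul_nonpos_of_nonneg_of_nonpos (by positivity) (hsign x hx)⟩
  obtain ⟨hcont, hint⟩ := integral_divergence_of_contDiffOn h.lt h.angle_pos (hp.mul hA) (hp.mul hB)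
  have hbdry : ∀ r, (∀ t ∈ Icc 0 d, W (r, t) = 0) → ∫ t in (0)..d, W (r, t) / V (r, t) *
      (r * (r * r) * (V (r, t) * dirDeriv K (1, 0) W (r, t) -
        W (r, t) * dirDeriv K (1, 0) V (r, t))) = 0 := by
    intro r hr
    rw [intervalIntegral.integral_congr (g := fun _ => (0 : ℝ)), intervalIntegral.integral_zero]
    intro t ht
    rw [uIcc_of_le h.angle_pos.le] at ht
    simp [hr t ht]
  -- Agreement of `V` and `W` on the edges passes to their radial derivatives; incompressibility
  -- then gives equal `V_θ`, and equal vorticity gives equal `W_θ`.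
  have hedge : ∫ r in a..b, W (r, d) / V (r, d) * (r * (V (r, d) * dirDeriv K (0, 1) W (r, d) -
        W (r, d) * dirDeriv K (0, 1) V (r, d))) =
      ∫ r in a..b, W (r, 0) / V (r, 0) * (r * (V (r, 0) * dirDeriv K (0, 1) W (r, 0) -
        W (r, 0) * dirDeriv K (0, 1) V (r, 0))) := by
    refine intervalIntegral.integral_congr fun r hr => ?_
    rw [uIcc_of_le h.lt.le] at hr
    have hω0 := h.vorticity_edge_eq hVe r hr
    have hVr0 := dirDeriv_radial_eq_of_section_eq h.lt hV hV h0 hd hVe hr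
    have hWr0 := dirDeriv_radial_eq_of_section_eq h.lt hW hW h0 hd hWe hr
    have d0 := h.divergence_eq_zero (r, 0) ⟨hr, h0⟩
    have d1 := h.divergence_eq_zero (r, d) ⟨hr, hd⟩
    have w0 := hωmul (r, 0) ⟨hr, h0⟩
    have w1 := hωmul (r, d) ⟨hr, hd⟩
    rw [← hK] at hVr0 hWr0 d0 d1 hω0
    rw [← hωdef] at hω0
    have hVt0 : dirDeriv K (0, 1) V (r, 0) = dirDeriv K (0, 1) V (r, d) := by
      linear_combination d0 - d1 - hWe r hr - r * hWr0
    have hWt0 : dirDeriv K (0, 1) W (r, 0) = dirDeriv K (0, 1) W (r, d) := by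
      linear_combination w0 - w1 - r * hω0 + r * hVr0 + hVe r hr
    rw [hVt0, hWt0, hVe r hr, hWe r hr]
  have hzero := eqOn_zero_of_setIntegral_eq_zero (isCompact_Icc.prod isCompact_Icc)
    (measurableSet_Icc.prod measurableSet_Icc)
    (subset_closure_interior_rect h.lt h.angle_pos) hcont
    (fun x hx => by
      obtain ⟨h1, h2, h3⟩ := hterm x hx
      exact (by linarith : (0 : ℝ) ≤ _ + _ - _).trans_eq (hdiv x hx).symm)
    (hint.trans (by
      have := hbdry b h.radial_outer
      have := hbdry a h.radial_inner
      linarith))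
  have hpr : ∀ x ∈ K, dirDeriv K (1, 0) (fun x => W x / V x) x = 0 := by
    intro x hx
    obtain ⟨h1, h2, h3⟩ := hterm x hx
    have h4 := (hdiv x hx).symm.trans (hzero x hx)
    have h5 : x.1 ^ 3 * V x ^ 2 * dirDeriv K (1, 0) (fun x => W x / V x) x ^ 2 = 0 := by linarith
    have hr := (h.radius_pos hx).ne'
    have hV0 := h.angular_ne_zero x hx
    simpa [hr, hV0] using h5
  rintro ⟨r, t⟩ ⟨hr, ht⟩
  have ha : a ∈ Icc a b := left_mem_Icc.2 h.lt.le
  -- `W / V` is constant along the ray and vanishes at `r = a`.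
  have := eq_of_hasDerivWithinAt_zero (f := fun s => W (s, t) / V (s, t)) (fun s hs => by
    have := hasDerivWithinAt_radial_section hp hs ht
    rwa [← hK, hpr (s, t) ⟨hs, ht⟩] at this) hr ha
  simp only [h.radial_inner t ht, zero_div] at this
  exact (div_eq_zero_iff.1 this).resolve_right (h.angular_ne_zero _ ⟨hr, ht⟩)

end PolarFlow

end SectorEuler

/-! ### Vorticity transport from the momentum equations -/

namespace SectorEuler

open MeasureTheory Set Topology

theorem closedPolar_mem_nhds {a b d : ℝ} {x : ℝ × ℝ} (hx : x ∈ Ioo a b ×ˢ Ioo 0 d) :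
    closedPolar a b d ∈ 𝓝 x :=
  Filter.mem_of_superset ((isOpen_Ioo.prod isOpen_Ioo).mem_nhds hx)
    (prod_mono Ioo_subset_Icc_self Ioo_subset_Icc_self)

/-- The components of the differential of a `C²` function satisfy the compatibility condition. -/
theorem dirDeriv_eq_of_hasFDerivAt {a b d : ℝ} {Q A B : ℝ × ℝ → ℝ}
    (hA : ContDiffOn ℝ 1 A (closedPolar a b d)) (hB : ContDiffOn ℝ 1 B (closedPolar a b d))
    (hQ : ∀ x ∈ Ioo a b ×ˢ Ioo 0 d, HasFDerivAt Q
      (A x • ContinuousLinearMap.fst ℝ ℝ ℝ + B x • ContinuousLinearMap.snd ℝ ℝ ℝ) x)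
    {x : ℝ × ℝ} (hx : x ∈ Ioo a b ×ˢ Ioo 0 d) :
    dirDeriv (closedPolar a b d) (0, 1) A x = dirDeriv (closedPolar a b d) (1, 0) B x := by
  have hn := closedPolar_mem_nhds hx
  have hAd := ((hA.differentiableOn one_ne_zero x
    (mem_of_mem_nhds hn)).hasFDerivWithinAt).hasFDerivAt hn
  have hBd := ((hB.differentiableOn one_ne_zero x
    (mem_of_mem_nhds hn)).hasFDerivWithinAt).hasFDerivAt hn
  have := second_derivative_symmetric_of_eventually (𝕜 := ℝ)
    (Filter.eventually_of_mem ((isOpen_Ioo.prod isOpen_Ioo).mem_nhds hx) hQ)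
    ((hAd.smul_const (ContinuousLinearMap.fst ℝ ℝ ℝ)).add
      (hBd.smul_const (ContinuousLinearMap.snd ℝ ℝ ℝ))) (0, 1) (1, 0)
  simpa [dirDeriv] using this

/-- An incompressible flow in polar components that obeys the momentum equations, with pressure
`Q`, transports its vorticity. -/
theorem PolarFlow.of_momentum {a b d : ℝ} {W V Q : ℝ × ℝ → ℝ} (ha : 0 < a) (hab : a < b)
    (hd : 0 < d) (hW2 : ContDiffOn ℝ 2 W (closedPolar a b d))
    (hV2 : ContDiffOn ℝ 2 V (closedPolar a b d)) (hV0 : ∀ x ∈ closedPolar a b d, V x ≠ 0)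
    (hdiv : ∀ x ∈ Ioo a b ×ˢ Ioo 0 d, W x + x.1 * dirDeriv (closedPolar a b d) (1, 0) W x
      + dirDeriv (closedPolar a b d) (0, 1) V x = 0)
    (hQ : ∀ x ∈ Ioo a b ×ˢ Ioo 0 d, HasFDerivAt Q
      ((V x * polarVorticity (closedPolar a b d) W V x -
          V x * dirDeriv (closedPolar a b d) (1, 0) V x -
          W x * dirDeriv (closedPolar a b d) (1, 0) W x) • ContinuousLinearMap.fst ℝ ℝ ℝ +
        (x.1 * (V x * dirDeriv (closedPolar a b d) (1, 0) W x -
          W x * dirDeriv (closedPolar a b d) (1, 0) V x)) • ContinuousLinearMap.snd ℝ ℝ ℝ) x)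
    (hinner : ∀ t ∈ Icc 0 d, W (a, t) = 0) (houter : ∀ t ∈ Icc 0 d, W (b, t) = 0) :
    PolarFlow a b d W V := by
  have hu := uniqueDiffOn_closedPolar hab hd
  have hcl : closedPolar a b d ⊆ closure (interior (closedPolar a b d)) :=
    subset_closure_interior_rect hab hd
  have hfst : ContDiffOn ℝ 1 (fun x : ℝ × ℝ => x.1) (closedPolar a b d) := contDiff_fst.contDiffOn
  have hW : ContDiffOn ℝ 1 W (closedPolar a b d) := hW2.of_le (by norm_num)
  have hV : ContDiffOn ℝ 1 V (closedPolar a b d) := hV2.of_le (by norm_num)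
  have hWr := contDiffOn_dirDeriv (v := (1, 0)) hu hW2
  have hVr := contDiffOn_dirDeriv (v := (1, 0)) hu hV2
  have hVt := contDiffOn_dirDeriv (v := (0, 1)) hu hV2
  have hω := contDiffOn_polarVorticity ha hab hd hW2 hV2
  have hdivK : ∀ x ∈ closedPolar a b d, W x + x.1 * dirDeriv (closedPolar a b d) (1, 0) W x
      + dirDeriv (closedPolar a b d) (0, 1) V x = 0 :=
    eqOn_rect_of_eqOn_interior hab hd
      ((hW.continuousOn.add (hfst.continuousOn.mul hWr.continuousOn)).add hVt.continuousOn) hdiv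
  refine ⟨ha, hab, hd, hW2, hV2, hV0, hdivK, ?_, hinner, houter⟩
  refine eqOn_rect_of_eqOn_interior hab hd
    (((hfst.continuousOn.mul hW.continuousOn).mul (continuousOn_dirDeriv hu hω)).add
      (hV.continuousOn.mul (continuousOn_dirDeriv hu hω))) fun x hx => ?_
  have hxK : x ∈ closedPolar a b d := mem_of_mem_nhds (closedPolar_mem_nhds hx)
  -- Taking the curl eliminates the pressure. `Q` is only assumed differentiable, but its partial
  -- derivatives are `C¹`, so the mixed second derivatives agree.
  have hS := dirDeriv_eq_of_hasFDerivAt (((hV.mul hω).sub (hV.mul hVr)).sub (hW.mul hWr))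
    (hfst.mul ((hV.mul hWr).sub (hW.mul hVr))) hQ hx
  rw [dirDeriv_sub hu ((hV.mul hω).sub (hV.mul hVr)) (hW.mul hWr) hxK,
    dirDeriv_sub hu (hV.mul hω) (hV.mul hVr) hxK, dirDeriv_mul hu hV hω hxK,
    dirDeriv_mul hu hV hVr hxK, dirDeriv_mul hu hW hWr hxK,
    dirDeriv_mul hu hfst ((hV.mul hWr).sub (hW.mul hVr)) hxK,
    dirDeriv_sub hu (hV.mul hWr) (hW.mul hVr) hxK, dirDeriv_mul hu hV hWr hxK,
    dirDeriv_mul hu hW hVr hxK, dirDeriv_fst hu hxK] at hS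
  have e1 := dirDeriv_polarVorticity_mul ha hab hd hW2 hV2 hxK (1, 0)
  have e3 := dirDeriv_divergence_eq_zero hab hd hW2 hV2 hdivK hxK (1, 0)
  have e6 := polarVorticity_mul (K := closedPolar a b d) (W := W) (V := V)
    (ha.trans_le hxK.1.1).ne'
  have e7 := hdivK x hxK
  have c1 := dirDeriv_comm (v := (1, 0)) (w := (0, 1)) hu hcl hV2 hxK
  have c2 := dirDeriv_comm (v := (1, 0)) (w := (0, 1)) hu hcl hW2 hxK
  linear_combination hS + V x * e3 + W x * e1 -
    (polarVorticity (closedPolar a b d) W V x - dirDeriv (closedPolar a b d) (1, 0) V x) * e7 +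
    dirDeriv (closedPolar a b d) (1, 0) W x * e6 - V x * c1 - W x * c2

/-! ### The rotating orthonormal frame -/

section Frame

theorem eR_eq (t : ℝ) : eR t = Real.cos t • EuclideanSpace.single 0 (1 : ℝ) +
    Real.sin t • EuclideanSpace.single 1 (1 : ℝ) := by
  ext i
  fin_cases i <;> simp [eR]

theorem eTheta_eq (t : ℝ) : eTheta t = (-Real.sin t) • EuclideanSpace.single 0 (1 : ℝ) +
    Real.cos t • EuclideanSpace.single 1 (1 : ℝ) := by
  ext i
  fin_cases i <;> simp [eTheta]

theorem polarPoint_eq_smul (r t : ℝ) : polarPoint r t = r • eR t := by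
  ext i
  fin_cases i <;> simp [eR, polarPoint]

theorem contDiff_eR : ContDiff ℝ 2 eR := by
  rw [funext eR_eq]
  exact (Real.contDiff_cos.smul contDiff_const).add (Real.contDiff_sin.smul contDiff_const)

theorem contDiff_eTheta : ContDiff ℝ 2 eTheta := by
  rw [funext eTheta_eq]
  exact (Real.contDiff_sin.neg.smul contDiff_const).add (Real.contDiff_cos.smul contDiff_const)

theorem hasDerivAt_eR (t : ℝ) : HasDerivAt eR (eTheta t) t := by
  rw [eTheta_eq, funext eR_eq]
  exact ((Real.hasDerivAt_cos t).smul_const _).add ((Real.hasDerivAt_sin t).smul_const _)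

theorem hasDerivAt_eTheta (t : ℝ) : HasDerivAt eTheta (-eR t) t := by
  rw [eR_eq, funext eTheta_eq, neg_add, ← neg_smul, ← neg_smul]
  exact ((Real.hasDerivAt_sin t).neg.smul_const _).add ((Real.hasDerivAt_cos t).smul_const _)

theorem eq_inner_eR_smul_add (v : Plane) (t : ℝ) :
    v = inner ℝ v (eR t) • eR t + inner ℝ v (eTheta t) • eTheta t := by
  ext i
  fin_cases i
  · simp [eR, eTheta, PiLp.inner_apply, Fin.sum_univ_two]
    linear_combination -v 0 * Real.cos_sq_add_sin_sq t
  · simp [eR, eTheta, PiLp.inner_apply, Fin.sum_univ_two]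
    linear_combination -v 1 * Real.cos_sq_add_sin_sq t

/-- The trace is the same in every orthonormal basis; this turns the Cartesian divergence into its
polar form. -/
theorem sum_apply_single_eq (L : Plane →L[ℝ] Plane) (t : ℝ) :
    ∑ i : Fin 2, (L (EuclideanSpace.single i 1)) i =
      inner ℝ (L (eR t)) (eR t) + inner ℝ (L (eTheta t)) (eTheta t) := by
  rw [eR_eq, eTheta_eq, map_add, map_add, map_smul, map_smul, map_smul, map_smul]
  simp [PiLp.inner_apply, Fin.sum_univ_two]
  linear_combination -((L (EuclideanSpace.single 0 1)) 0 + (L (EuclideanSpace.single 1 1)) 1) *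
    Real.cos_sq_add_sin_sq t

end Frame

/-! ### The Euler equations in polar components -/

section Euler

variable {a b d : ℝ} {u : Plane → Plane} {P : Plane → ℝ} {U : ℝ × ℝ → Plane}

theorem contDiffOn_radial (hU : ContDiffOn ℝ 2 U (closedPolar a b d)) :
    ContDiffOn ℝ 2 (fun x => radial U x.1 x.2) (closedPolar a b d) :=
  hU.inner ℝ (contDiff_eR.comp contDiff_snd).contDiffOn

theorem contDiffOn_angular (hU : ContDiffOn ℝ 2 U (closedPolar a b d)) :
    ContDiffOn ℝ 2 (fun x => angular U x.1 x.2) (closedPolar a b d) :=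
  hU.inner ℝ (contDiff_eTheta.comp contDiff_snd).contDiffOn

theorem dirDeriv_radial_eq_of_hasDerivAt {F : ℝ × ℝ → ℝ} (hab : a < b)
    (hF : ContDiffOn ℝ 1 F (closedPolar a b d)) {r t D : ℝ} (hr : r ∈ Icc a b) (ht : t ∈ Icc 0 d)
    (h : HasDerivAt (fun s => F (s, t)) D r) : dirDeriv (closedPolar a b d) (1, 0) F (r, t) = D :=
  (uniqueDiffOn_Icc hab r hr).eq_deriv _ (hasDerivWithinAt_radial_section hF hr ht)
    h.hasDerivWithinAt

theorem dirDeriv_angular_eq_of_hasDerivAt {F : ℝ × ℝ → ℝ} (hd : 0 < d)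
    (hF : ContDiffOn ℝ 1 F (closedPolar a b d)) {r t D : ℝ} (hr : r ∈ Icc a b) (ht : t ∈ Icc 0 d)
    (h : HasDerivAt (fun s => F (r, s)) D t) : dirDeriv (closedPolar a b d) (0, 1) F (r, t) = D :=
  (uniqueDiffOn_Icc hd t ht).eq_deriv _ (hasDerivWithinAt_angular_section hF hr ht)
    h.hasDerivWithinAt

theorem hasDerivAt_polarPoint_radius (r t : ℝ) :
    HasDerivAt (fun s => polarPoint s t) (eR t) r := by
  simp only [polarPoint_eq_smul]
  simpa using (hasDerivAt_id r).smul_const (eR t)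

theorem hasDerivAt_polarPoint_angle (r t : ℝ) :
    HasDerivAt (fun s => polarPoint r s) (r • eTheta t) t := by
  simp only [polarPoint_eq_smul]
  exact (hasDerivAt_eR t).const_smul r

/-- The polar components of the differential of the velocity. -/
theorem dirDeriv_components (hab : a < b) (hd : 0 < d) (hU : IsC2UpToBoundary a b d u U) {r t : ℝ}
    (hr : r ∈ Ioo a b) (ht : t ∈ Ioo 0 d) (hu : DifferentiableAt ℝ u (polarPoint r t)) :
    dirDeriv (closedPolar a b d) (1, 0) (fun x => radial U x.1 x.2) (r, t) =
        inner ℝ (fderiv ℝ u (polarPoint r t) (eR t)) (eR t) ∧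
      dirDeriv (closedPolar a b d) (1, 0) (fun x => angular U x.1 x.2) (r, t) =
        inner ℝ (fderiv ℝ u (polarPoint r t) (eR t)) (eTheta t) ∧
      dirDeriv (closedPolar a b d) (0, 1) (fun x => radial U x.1 x.2) (r, t) =
        r * inner ℝ (fderiv ℝ u (polarPoint r t) (eTheta t)) (eR t) + angular U r t ∧
      dirDeriv (closedPolar a b d) (0, 1) (fun x => angular U x.1 x.2) (r, t) =
        r * inner ℝ (fderiv ℝ u (polarPoint r t) (eTheta t)) (eTheta t) - radial U r t := by
  have hW := (contDiffOn_radial hU.1).of_le (m := 1) (by norm_num)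
  have hV := (contDiffOn_angular hU.1).of_le (m := 1) (by norm_num)
  have hr' := Ioo_subset_Icc_self hr
  have ht' := Ioo_subset_Icc_self ht
  have hUr : HasDerivAt (fun s => U (s, t)) (fderiv ℝ u (polarPoint r t) (eR t)) r := by
    refine (hu.hasFDerivAt.comp_hasDerivAt r
      (hasDerivAt_polarPoint_radius r t)).congr_of_eventuallyEq ?_
    filter_upwards [isOpen_Ioo.mem_nhds hr] with s hs using (hU.2 s hs t ht).symm
  have hUt : HasDerivAt (fun s => U (r, s)) (fderiv ℝ u (polarPoint r t) (r • eTheta t)) t := by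
    refine (hu.hasFDerivAt.comp_hasDerivAt t
      (hasDerivAt_polarPoint_angle r t)).congr_of_eventuallyEq ?_
    filter_upwards [isOpen_Ioo.mem_nhds ht] with s hs using (hU.2 r hr s hs).symm
  refine ⟨dirDeriv_radial_eq_of_hasDerivAt hab hW hr' ht' ?_,
    dirDeriv_radial_eq_of_hasDerivAt hab hV hr' ht' ?_,
    dirDeriv_angular_eq_of_hasDerivAt hd hW hr' ht' ?_,
    dirDeriv_angular_eq_of_hasDerivAt hd hV hr' ht' ?_⟩
  · exact (hUr.inner ℝ (hasDerivAt_const r (eR t))).congr_deriv (by simp)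
  · exact (hUr.inner ℝ (hasDerivAt_const r (eTheta t))).congr_deriv (by simp)
  · refine (hUt.inner ℝ (hasDerivAt_eR t)).congr_deriv ?_
    rw [map_smul, real_inner_smul_left, add_comm]
    rfl
  · refine (hUt.inner ℝ (hasDerivAt_eTheta t)).congr_deriv ?_
    rw [map_smul, real_inner_smul_left, inner_neg_right, neg_add_eq_sub]
    rfl

theorem divergence_eq_zero_polar (hab : a < b) (hd : 0 < d) (hU : IsC2UpToBoundary a b d u U)
    (hE : IsEulerSolution (sector a b d) u P) :
    ∀ x ∈ Ioo a b ×ˢ Ioo 0 d, radial U x.1 x.2 +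
      x.1 * dirDeriv (closedPolar a b d) (1, 0) (fun x => radial U x.1 x.2) x +
      dirDeriv (closedPolar a b d) (0, 1) (fun x => angular U x.1 x.2) x = 0 := by
  rintro ⟨r, t⟩ ⟨hr, ht⟩
  obtain ⟨hu, -, -, hdiv⟩ := hE (polarPoint r t) ⟨r, hr, t, ht, rfl⟩
  obtain ⟨h1, -, -, h4⟩ := dirDeriv_components hab hd hU hr ht hu
  rw [divergence, sum_apply_single_eq _ t] at hdiv
  rw [h1, h4]
  linear_combination r * hdiv

/-- The radial momentum equation is rewritten with `ω`, absorbing `V² / r` and `V W_θ / r`. In the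
angular one, incompressibility replaces `V_θ + W` by `-r W_r`. -/
theorem hasFDerivAt_pressure_polar (ha : 0 < a) (hab : a < b) (hd : 0 < d)
    (hU : IsC2UpToBoundary a b d u U) (hE : IsEulerSolution (sector a b d) u P) :
    ∀ x ∈ Ioo a b ×ˢ Ioo 0 d, HasFDerivAt (fun x : ℝ × ℝ => P (polarPoint x.1 x.2))
      ((angular U x.1 x.2 * polarVorticity (closedPolar a b d) (fun x => radial U x.1 x.2)
            (fun x => angular U x.1 x.2) x -
          angular U x.1 x.2 *
            dirDeriv (closedPolar a b d) (1, 0) (fun x => angular U x.1 x.2) x -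
          radial U x.1 x.2 * dirDeriv (closedPolar a b d) (1, 0) (fun x => radial U x.1 x.2) x) •
            ContinuousLinearMap.fst ℝ ℝ ℝ +
        (x.1 * (angular U x.1 x.2 *
            dirDeriv (closedPolar a b d) (1, 0) (fun x => radial U x.1 x.2) x -
          radial U x.1 x.2 * dirDeriv (closedPolar a b d) (1, 0) (fun x => angular U x.1 x.2) x)) •
            ContinuousLinearMap.snd ℝ ℝ ℝ) x := by
  rintro ⟨r, t⟩ ⟨hr, ht⟩
  have hr0 : r ≠ 0 := (ha.trans hr.1).ne'
  obtain ⟨hu, hP, hmom, hdiv⟩ := hE (polarPoint r t) ⟨r, hr, t, ht, rfl⟩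
  obtain ⟨h1, h2, h3, h4⟩ := dirDeriv_components hab hd hU hr ht hu
  rw [divergence, sum_apply_single_eq _ t] at hdiv
  have hpolar : DifferentiableAt ℝ (fun x : ℝ × ℝ => polarPoint x.1 x.2) (r, t) := by
    simp only [polarPoint_eq_smul]
    exact differentiableAt_fst.smul
      ((hasDerivAt_eR t).differentiableAt.comp (r, t)
        (differentiableAt_snd (𝕜 := ℝ) (p := ((r, t) : ℝ × ℝ))))
  have hQ : DifferentiableAt ℝ (fun x : ℝ × ℝ => P (polarPoint x.1 x.2)) (r, t) :=
    DifferentiableAt.comp (r, t) (g := P) hP hpolar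
  have hgrad : ∀ v, fderiv ℝ P (polarPoint r t) v = inner ℝ (gradient P (polarPoint r t)) v := by
    intro v
    rw [hP.hasGradientAt.hasFDerivAt.fderiv]
    simp
  have hQr : fderiv ℝ (fun x : ℝ × ℝ => P (polarPoint x.1 x.2)) (r, t) (1, 0) =
      inner ℝ (gradient P (polarPoint r t)) (eR t) := by
    rw [← hgrad]
    exact (hQ.hasFDerivAt.comp_hasDerivAt r
      ((hasDerivAt_id r).prodMk (hasDerivAt_const r t))).unique
      (hP.hasFDerivAt.comp_hasDerivAt r (hasDerivAt_polarPoint_radius r t))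
  have hQt : fderiv ℝ (fun x : ℝ × ℝ => P (polarPoint x.1 x.2)) (r, t) (0, 1) =
      r * inner ℝ (gradient P (polarPoint r t)) (eTheta t) := by
    rw [← real_inner_smul_right, ← hgrad]
    exact (hQ.hasFDerivAt.comp_hasDerivAt t
      ((hasDerivAt_const t r).prodMk (hasDerivAt_id t))).unique
      (hP.hasFDerivAt.comp_hasDerivAt t (hasDerivAt_polarPoint_angle r t))
  have hdec : u (polarPoint r t) = radial U r t • eR t + angular U r t • eTheta t := by
    rw [hU.2 r hr t ht]
    exact eq_inner_eR_smul_add _ t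
  have hg : ∀ v, inner ℝ (gradient P (polarPoint r t)) v =
      -(radial U r t * inner ℝ (fderiv ℝ u (polarPoint r t) (eR t)) v +
        angular U r t * inner ℝ (fderiv ℝ u (polarPoint r t) (eTheta t)) v) := by
    intro v
    rw [eq_neg_of_add_eq_zero_right hmom, inner_neg_left]
    conv_lhs => rw [hdec]
    rw [map_add, map_smul, map_smul, inner_add_left, real_inner_smul_left, real_inner_smul_left]
  refine hQ.hasFDerivAt.congr_fderiv ?_
  ext
  · simp only [ContinuousLinearMap.comp_apply, ContinuousLinearMap.inl_apply]
    rw [hQr, hg]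
    simp [polarVorticity, h1, h2, h3]
    field_simp
    ring
  · simp only [ContinuousLinearMap.comp_apply, ContinuousLinearMap.inr_apply]
    rw [hQt, hg]
    simp only [h1, h2, add_apply, smul_apply,
      ContinuousLinearMap.coe_fst', ContinuousLinearMap.coe_snd', smul_eq_mul, mul_zero, mul_one,
      zero_add]
    linear_combination -(r * angular U r t) * hdiv

end Euler

end SectorEuler

/-! ### Homogeneity, sign of the angular velocity and the edge condition -/

namespace SectorEuler

open MeasureTheory Set Topology

theorem norm_eR (t : ℝ) : ‖eR t‖ = 1 := by
  rw [EuclideanSpace.norm_eq, Fin.sum_univ_two]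
  simp [eR]

/-- Rescaling a point within a sector rescales the radius and keeps the direction. -/
theorem polarPoint_eq_smul_polarPoint {r r' t t' s : ℝ} (hr : 0 < r) (hr' : 0 < r') (hs : 0 < s)
    (h : s • polarPoint r t = polarPoint r' t') : r' = s * r ∧ eTheta t' = eTheta t := by
  rw [polarPoint_eq_smul, polarPoint_eq_smul, smul_smul] at h
  have hn := congrArg norm h
  rw [norm_smul, norm_smul, norm_eR, norm_eR, mul_one, mul_one, Real.norm_of_nonneg (by positivity),
    Real.norm_of_nonneg hr'.le] at hn
  refine ⟨hn.symm, ?_⟩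
  rw [hn] at h
  have he := smul_right_injective Plane hr'.ne' h
  have h0 := congrFun (congrArg WithLp.ofLp he) 0
  have h1 := congrFun (congrArg WithLp.ofLp he) 1
  simp only [eR] at h0 h1
  simp at h0 h1
  rw [eTheta, eTheta, h0, h1]

/-- The angle enters only through `e_θ`, which is determined by the direction of the point, so
uniqueness of the polar angle is never needed. -/
theorem homogeneousWithin_of_polar {a b d β : ℝ} {E : Type*} [AddCommGroup E] [Module ℝ E]
    (ha : 0 < a) {f : Plane → E} {g : Plane → E}
    (hf : ∀ r ∈ Ioo a b, ∀ t ∈ Ioo 0 d, f (polarPoint r t) = (r ^ β) • g (eTheta t)) :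
    HomogeneousWithin β (sector a b d) f := by
  rintro x ⟨r, hr, t, ht, rfl⟩ s hs ⟨r', hr', t', ht', h⟩
  have hr0 := ha.trans hr.1
  obtain ⟨h1, h2⟩ := polarPoint_eq_smul_polarPoint hr0 (ha.trans hr'.1) hs h
  rw [h, hf r hr t ht, hf r' hr' t' ht', h2, h1, Real.mul_rpow hs.le hr0.le, mul_smul]

/-- If the angular velocity is nonzero on a truncated sector then it has a constant sign. -/
theorem PolarFlow.angular_mul_pos {a b d c : ℝ} {W V : ℝ × ℝ → ℝ} (h : PolarFlow a b d W V)
    {y : ℝ × ℝ} (hy : y ∈ closedPolar a b d) (hc : 0 < c * V y) :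
    ∀ x ∈ closedPolar a b d, 0 < c * V x := by
  intro x hx
  by_contra hneg
  have hconn : IsPreconnected (closedPolar a b d) :=
    ((convex_Icc a b).prod (convex_Icc 0 d)).isPreconnected
  obtain ⟨z, hz, hz0⟩ := hconn.intermediate_value hx hy
    (continuousOn_const.mul h.contDiffOn_angular.continuousOn) ⟨not_lt.1 hneg, hc.le⟩
  rcases mul_eq_zero.1 hz0 with h0 | h0
  · simp [h0] at hc
  · exact h.angular_ne_zero z hz h0

/-- A positive multiple of the vorticity on a ray, in terms of the angular derivative of the
weighted radial velocity. -/
theorem vorticity_nonpos_of_dThetaRadial {a b d α c t : ℝ} {U : ℝ × ℝ → Plane} (ha : 0 < a)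
    (hab : a < b) (hd : 0 < d) (hU : ContDiffOn ℝ 2 U (closedPolar a b d)) (hc : c ≠ 0)
    (ht : t ∈ Icc 0 d) (hV : ∀ r ∈ Icc a b, angular U r t = c / r ^ α)
    (hs : ∀ r ∈ Icc a b, 1 - α ≤ c⁻¹ * dThetaRadial α d U r t) :
    ∀ r ∈ Icc a b, c * polarVorticity (closedPolar a b d) (fun x => radial U x.1 x.2)
      (fun x => angular U x.1 x.2) (r, t) ≤ 0 := by
  intro r hr
  have hr0 : 0 < r := ha.trans_le hr.1
  have hW1 := (contDiffOn_radial hU).of_le (m := 1) (by norm_num)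
  have hV1 := (contDiffOn_angular hU).of_le (m := 1) (by norm_num)
  have h1 : dThetaRadial α d U r t =
      r ^ α * dirDeriv (closedPolar a b d) (0, 1) (fun x => radial U x.1 x.2) (r, t) :=
    ((hasDerivWithinAt_angular_section hW1 hr ht).const_mul (r ^ α)).derivWithin
      (uniqueDiffOn_Icc hd t ht)
  have h2 : dirDeriv (closedPolar a b d) (1, 0) (fun x => angular U x.1 x.2) (r, t) =
      c * (-α * r ^ (-α - 1)) := by
    refine (uniqueDiffOn_Icc hab r hr).eq_deriv _ (hasDerivWithinAt_radial_section hV1 hr ht) ?_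
    refine (((Real.hasDerivAt_rpow_const (p := -α) (Or.inl hr0.ne')).const_mul
      c).hasDerivWithinAt).congr (fun s hs => ?_) ?_
    · simp only
      rw [hV s hs, Real.rpow_neg (ha.trans_le hs.1).le, div_eq_mul_inv]
    · simp only
      rw [hV r hr, Real.rpow_neg hr0.le, div_eq_mul_inv]
  have h3 := hs r hr
  rw [h1] at h3
  have hp : 0 < r ^ α := Real.rpow_pos_of_pos hr0 α
  rw [polarVorticity, h2, Real.rpow_sub_one hr0.ne', Real.rpow_neg hr0.le]
  simp only
  rw [hV r hr]
  set D := dirDeriv (closedPolar a b d) (0, 1) (fun x => radial U x.1 x.2) (r, t)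
  -- The left side is `c ω` for `V = c r^(-α)` on the ray, and the last factor on the right is the
  -- slack in the edge hypothesis: that hypothesis is equivalent to `c ω ≤ 0`.
  have : c * (c * (-α * ((r ^ α)⁻¹ / r)) + (c / r ^ α - D) / r) =
      -(c ^ 2 / (r * r ^ α) * (c⁻¹ * (r ^ α * D) - (1 - α))) := by
    field_simp
    ring
  rw [this]
  have h4 := sub_nonneg.2 h3
  exact neg_nonpos.2 (by positivity)

end SectorEuler

/-! ### The rigidity theorem -/

theorem theorem3 (α θ₀ c₁ c₂ : ℝ) (hα : 1 ≤ α) (hθ₀ : 0 < θ₀) (hθ₀' : θ₀ ≤ 2 * Real.pi)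
    (u : SectorEuler.Plane → SectorEuler.Plane) (P : SectorEuler.Plane → ℝ)
    (U : ℝ × ℝ → SectorEuler.Plane)
    (hU : SectorEuler.IsC2UpToBoundary 1 2 θ₀ u U)
    (hEuler : SectorEuler.IsEulerSolution (SectorEuler.sector 1 2 θ₀) u P)
    (hpos : ∀ r ∈ Set.Icc (1 : ℝ) 2, ∀ θ ∈ Set.Icc 0 θ₀, 0 < |SectorEuler.angular U r θ|)
    (hbot : ∀ r ∈ Set.Icc (1 : ℝ) 2, SectorEuler.angular U r 0 = c₁ / r ^ α)
    (htop : ∀ r ∈ Set.Icc (1 : ℝ) 2, SectorEuler.angular U r θ₀ = c₂ / r ^ α)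
    (hrad : ∀ r ∈ Set.Icc (1 : ℝ) 2, SectorEuler.radial U r 0 = SectorEuler.radial U r θ₀)
    (hleft : ∀ θ ∈ Set.Icc 0 θ₀, SectorEuler.radial U 1 θ = 0)
    (hright : ∀ θ ∈ Set.Icc 0 θ₀, SectorEuler.radial U 2 θ = 0) :
    ∃ c : ℝ, c₁ = c ∧ c₂ = c ∧ c ≠ 0 ∧
      (((∀ r ∈ Set.Icc (1 : ℝ) 2, 1 - α ≤ c⁻¹ * SectorEuler.dThetaRadial α θ₀ U r 0) ∨
        (∀ r ∈ Set.Icc (1 : ℝ) 2, 1 - α ≤ c⁻¹ * SectorEuler.dThetaRadial α θ₀ U r θ₀)) →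
        SectorEuler.HomogeneousWithin (-α) (SectorEuler.sector 1 2 θ₀) u ∧
        (∀ r ∈ Set.Icc (1 : ℝ) 2, ∀ θ ∈ Set.Icc 0 θ₀,
          U (r, θ) = (c / r ^ α) • SectorEuler.eTheta θ) ∧
        (∀ r ∈ Set.Ioo (1 : ℝ) 2, ∀ θ ∈ Set.Ioo 0 θ₀,
          u (SectorEuler.polarPoint r θ) = (c / r ^ α) • SectorEuler.eTheta θ) ∧
        ∃ C : ℝ,
          SectorEuler.HomogeneousWithin (-(2 * α)) (SectorEuler.sector 1 2 θ₀)
            (fun x => P x - C) ∧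
          ∀ r ∈ Set.Ioo (1 : ℝ) 2, ∀ θ ∈ Set.Ioo 0 θ₀,
            P (SectorEuler.polarPoint r θ) = -(c ^ 2 / (2 * α)) / r ^ (2 * α) + C) := by
  open SectorEuler Set in
  have hQ := hasFDerivAt_pressure_polar one_pos one_lt_two hθ₀ hU hEuler
  have hflow : PolarFlow 1 2 θ₀ (fun x => radial U x.1 x.2) (fun x => angular U x.1 x.2) :=
    PolarFlow.of_momentum one_pos one_lt_two hθ₀ (contDiffOn_radial hU.1) (contDiffOn_angular hU.1)
      (fun x hx => abs_pos.1 (hpos x.1 hx.1 x.2 hx.2))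
      (divergence_eq_zero_polar one_lt_two hθ₀ hU hEuler) hQ hleft hright
  have h0 : (0 : ℝ) ∈ Icc 0 θ₀ := left_mem_Icc.2 hθ₀.le
  have hd : θ₀ ∈ Icc 0 θ₀ := right_mem_Icc.2 hθ₀.le
  have h1 : (1 : ℝ) ∈ Icc (1 : ℝ) 2 := left_mem_Icc.2 one_le_two
  have hc1 : c₁ ≠ 0 := by
    have := abs_pos.1 (hpos 1 h1 0 h0)
    rw [hbot 1 h1, Real.one_rpow, div_one] at this
    exact this
  -- The angular fluxes through the edges are `c₁` and `c₂` times the same positive integral of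
  -- `r^(-α)`.
  have hc : c₂ = c₁ := by
    have hflux := hflow.integral_angular h0 hd
    rw [intervalIntegral.integral_congr (g := fun r => c₁ * (r ^ α)⁻¹),
      intervalIntegral.integral_congr (f := fun r => angular U (r, θ₀).1 (r, θ₀).2)
        (g := fun r => c₂ * (r ^ α)⁻¹), intervalIntegral.integral_const_mul,
      intervalIntegral.integral_const_mul] at hflux
    · have hpos : 0 < ∫ r in (1 : ℝ)..2, (r ^ α)⁻¹ := by
        refine intervalIntegral.intervalIntegral_pos_of_pos_on ?_ (fun r hr => ?_) one_lt_two
        · refine ContinuousOn.intervalIntegrable_of_Icc one_le_two fun r hr => ?_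
          have hr0 : 0 < r := one_pos.trans_le hr.1
          exact ((Real.continuousAt_rpow_const r α (Or.inl hr0.ne')).inv₀
            (Real.rpow_pos_of_pos hr0 α).ne').continuousWithinAt
        · exact inv_pos.2 (Real.rpow_pos_of_pos (one_pos.trans hr.1) α)
      exact (mul_right_cancel₀ hpos.ne' hflux).symm
    · intro r hr
      rw [uIcc_of_le one_le_two] at hr
      exact (htop r hr).trans (div_eq_mul_inv _ _)
    · intro r hr
      rw [uIcc_of_le one_le_two] at hr
      exact (hbot r hr).trans (div_eq_mul_inv _ _)
  subst hc
  refine ⟨c₂, rfl, rfl, hc1, fun hedge => ?_⟩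
  have hcV : ∀ x ∈ closedPolar 1 2 θ₀, 0 < c₂ * angular U x.1 x.2 := by
    refine hflow.angular_mul_pos (y := (1, 0)) ⟨h1, h0⟩ ?_
    simp only
    rw [hbot 1 h1, Real.one_rpow, div_one]
    exact mul_self_pos.2 hc1
  have hω : ∀ x ∈ closedPolar 1 2 θ₀, c₂ * polarVorticity (closedPolar 1 2 θ₀)
      (fun x => radial U x.1 x.2) (fun x => angular U x.1 x.2) x ≤ 0 := by
    rcases hedge with hedge | hedge
    · exact hflow.vorticity_mul_nonpos hcV h0
        (vorticity_nonpos_of_dThetaRadial one_pos one_lt_two hθ₀ hU.1 hc1 h0 hbot hedge)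
    · exact hflow.vorticity_mul_nonpos hcV hd
        (vorticity_nonpos_of_dThetaRadial one_pos one_lt_two hθ₀ hU.1 hc1 hd htop hedge)
  have hW : ∀ x ∈ closedPolar 1 2 θ₀, radial U x.1 x.2 = 0 :=
    hflow.radial_eq_zero hcV hω (fun r hr => (hbot r hr).trans (htop r hr).symm) hrad
  have hWd : ∀ v, ∀ x ∈ closedPolar 1 2 θ₀,
      dirDeriv (closedPolar 1 2 θ₀) v (fun x => radial U x.1 x.2) x = 0 := fun v x hx =>
    (dirDeriv_congr (G := fun _ => 0) hW hx).trans (dirDeriv_const 0)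
  -- With `W = 0`, incompressibility reads `V_θ = 0`, so `V` keeps its edge value along each arc.
  have hV : ∀ r ∈ Icc (1 : ℝ) 2, ∀ t ∈ Icc 0 θ₀, angular U r t = c₂ / r ^ α := by
    intro r hr t ht
    rw [← hbot r hr]
    refine eq_of_hasDerivWithinAt_zero (f := fun s => angular U r s) (fun s hs => ?_) ht h0
    have := hasDerivWithinAt_angular_section hflow.contDiffOn_one_angular hr hs
    have hdiv := hflow.divergence_eq_zero (r, s) ⟨hr, hs⟩
    rw [hWd _ (r, s) ⟨hr, hs⟩, hW (r, s) ⟨hr, hs⟩, mul_zero, add_zero, zero_add] at hdiv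
    rwa [hdiv] at this
  have hUeq : ∀ r ∈ Icc (1 : ℝ) 2, ∀ t ∈ Icc 0 θ₀, U (r, t) = (c₂ / r ^ α) • eTheta t := by
    intro r hr t ht
    have hr0 : radial U r t = 0 := hW (r, t) ⟨hr, ht⟩
    have hdec := eq_inner_eR_smul_add (U (r, t)) t
    change U (r, t) = radial U r t • eR t + angular U r t • eTheta t at hdec
    rw [hdec, hr0, hV r hr t ht, zero_smul, zero_add]
  have hueq : ∀ r ∈ Ioo (1 : ℝ) 2, ∀ t ∈ Ioo 0 θ₀,
      u (polarPoint r t) = (c₂ / r ^ α) • eTheta t := fun r hr t ht =>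
    (hU.2 r hr t ht).trans (hUeq r (Ioo_subset_Icc_self hr) t (Ioo_subset_Icc_self ht))
  -- For `W = 0` the pressure differential is `(V² / r) dr = c² r^(-2α-1) dr`, which the added power
  -- of `r` cancels.
  have hPconst : ∀ x ∈ Ioo (1 : ℝ) 2 ×ˢ Ioo 0 θ₀, HasFDerivAt
      (fun x : ℝ × ℝ => P (polarPoint x.1 x.2) + c₂ ^ 2 / (2 * α) * x.1 ^ (-(2 * α)))
      (0 : ℝ × ℝ →L[ℝ] ℝ) x := by
    intro x hx
    have hxK : x ∈ closedPolar 1 2 θ₀ :=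
      ⟨Ioo_subset_Icc_self hx.1, Ioo_subset_Icc_self hx.2⟩
    have hx0 : 0 < x.1 := one_pos.trans hx.1.1
    have hpow := ((Real.hasDerivAt_rpow_const (p := -(2 * α)) (Or.inl hx0.ne')).const_mul
      (c₂ ^ 2 / (2 * α))).comp_hasFDerivAt x (hasFDerivAt_fst (𝕜 := ℝ) (p := x))
    refine ((hQ x hx).add hpow).congr_fderiv ?_
    rw [hWd _ x hxK, hW x hxK, polarVorticity, hWd _ x hxK, hV x.1 hxK.1 x.2 hxK.2,
      Real.rpow_sub_one hx0.ne', Real.rpow_neg hx0.le, two_mul, Real.rpow_add hx0]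
    have hp : 0 < x.1 ^ α := Real.rpow_pos_of_pos hx0 α
    have hα0 : α ≠ 0 := by positivity
    ext
    · simp
      field_simp
      ring
    · simp
  obtain ⟨C, hC⟩ : ∃ C, ∀ x ∈ Ioo (1 : ℝ) 2 ×ˢ Ioo 0 θ₀,
      P (polarPoint x.1 x.2) + c₂ ^ 2 / (2 * α) * x.1 ^ (-(2 * α)) = C :=
    (isOpen_Ioo.prod isOpen_Ioo).exists_is_const_of_fderiv_eq_zero
      (isPreconnected_Ioo.prod isPreconnected_Ioo)
      (fun x hx => (hPconst x hx).differentiableAt.differentiableWithinAt)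
      (fun x hx => (hPconst x hx).fderiv)
  have hPeq : ∀ r ∈ Ioo (1 : ℝ) 2, ∀ t ∈ Ioo 0 θ₀,
      P (polarPoint r t) = -(c₂ ^ 2 / (2 * α)) / r ^ (2 * α) + C := by
    intro r hr t ht
    rw [← hC (r, t) ⟨hr, ht⟩, Real.rpow_neg (one_pos.trans hr.1).le]
    ring
  refine ⟨?_, hUeq, hueq, C, ?_, hPeq⟩
  · refine homogeneousWithin_of_polar one_pos (g := fun e => c₂ • e) fun r hr t ht => ?_
    rw [hueq r hr t ht, smul_smul, Real.rpow_neg (one_pos.trans hr.1).le, div_eq_inv_mul]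
  · refine homogeneousWithin_of_polar one_pos (g := fun _ => -(c₂ ^ 2 / (2 * α)))
      fun r hr t ht => ?_
    rw [hPeq r hr t ht, Real.rpow_neg (one_pos.trans hr.1).le, smul_eq_mul]
    ring
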